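/- Fix an integer $n\ge 1$. Consider unit squares $s_{x,y}$, $(x,y)\in\mathbb Z^2$; squares are adjacent if they share an edge, the level of $s_{x,y}$ is $x+y$, and its color is its level modulo $n$. An order-$n$ ribbon tile is a connected set of squares containing exactly one square of each color; its level is the level of its lowest square (the one with smallest $x+y$). A region $R$ is a finite connected set of squares; it is simply connected if no closed path of successively adjacent squares of $R$ has nonzero winding number around a square not in $R$. An order-$n$ ribbon tiling of $R$ is a partition of $R$ into order-$n$ ribbon tiles. Let $B_R$ be the set of squares not in $R$ that are adjacent to a square of $R$. Write $s_{x,y}\prec s_{x',y'}$ if either $x+y=x'+y'$ and $x<x'$, or $|(x+y)-(x'+y')|=1$, $x\le x'$ and $y\ge y'$. For sets of squares write $a\prec b$ if $s\prec s'$ for some $s\in a$, $s'\in b$ (a single square being identified with the corresponding one-element set). For a tiling $\alpha$ let $t_{c,i}(\alpha)$, $i\ge 1$, be the $i$-th tile of level $c$ of $\alpha$ from left to right (with respect to $\prec$), when it exists. Let $G_R(\alpha)$ be the oriented graph whose vertices are the symbols $t_{c,i}$ for which $t_{c,i}(\alpha)$ exists, together with the squares in $B_R$, where two distinct vertices $v,w$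 are joined by an edge oriented from $v$ to $w$ exactly when the tile or square represented by $v$ in $\alpha$ is $\prec$ the one represented by $w$. Let $G_R$ be the graph whose vertices are the squares in $B_R$ and the symbols $t_{c,i}$ for which $t_{c,i}(\alpha)$ exists for some order-$n$ ribbon tiling $\alpha$ of $R$, and whose edges are the (unoriented) edges of the $G_R(\alpha)$ for order-$n$ ribbon tilings $\alpha$ of $R$. An edge of $G_R$ is free if it joins $t_{c,i}$ and $t_{d,j}$ with $c\not\equiv d \pmod n$, and forced otherwise. The partial orientation of $G_R$ orients a forced edge from $v$ to $w$ if it is so oriented in $G_R(\alpha)$ for some order-$n$ ribbon tiling $\alpha$ of $R$. An orientation of $G_R$ assigns to every edge exactly one of its two directions; it extends the partial orientation if it agrees with it on the forced edges, and is acyclic if it has no directed cycle. Theorem. Let $R$ be a simply connected region that has at least one order-$n$ ribbon tiling. Then: 1. for every order-$n$ ribbon tiling $\alpha$ of $R$, $G_R(\alpha)$ is an acyclic orientation of $G_R$ (in particular, it has the same vertices and edges as $G_R$) that extends the partial orientation of $G_R$; 2. for order-$n$ ribbon tilings $\alpha,\beta$ of $R$, $\alpha=\beta$ if and only if $G_R(\alpha)=G_R(\beta)$;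 3. every acyclic orientation of $G_R$ that extends the partial orientation of $G_R$ is equal to $G_R(\alpha)$ for some order-$n$ ribbon tiling $\alpha$ of $R$; so $\alpha\mapsto G_R(\alpha)$ is a bijection from the order-$n$ ribbon tilings of $R$ onto the acyclic orientations of $G_R$ extending its partial orientation. Moreover: 4. two order-$n$ ribbon tilings $\alpha$ and $\beta$ of $R$ differ by a local replacement move (that is, $\beta$ is obtained from $\alpha$ by removing a pair of tiles and adding a different pair of tiles in its place) if and only if $G_R(\alpha)$ and $G_R(\beta)$ differ by an edge reversal (that is, they agree on all edges but exactly one). -/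

import Mathlib

namespace Ribbon

/-- Unit squares of the two-dimensional grid, indexed by their integer position `(x, y)`. -/
abbrev Square : Type := ℤ × ℤ

/-- The level `x + y` of the square `(x, y)`. Its colour is its level modulo `n`. -/
def level (s : Square) : ℤ := s.1 + s.2

/-- Two squares are adjacent if they share an edge. -/
def grid : SimpleGraph Square where
  Adj s s' := |s.1 - s'.1| + |s.2 - s'.2| = 1
  symm := ⟨fun s s' h => by rwa [abs_sub_comm s'.1, abs_sub_comm s'.2]⟩
  loopless := ⟨fun s h => by simp at h⟩

/-! ### Regions -/

/-- Signed crossing of an oriented lattice step `a → b` (a unit step between centres of adjacent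
squares) with the horizontal ray to the right of the centre of `s`, shifted up by one half: `+1` if
the step crosses the ray upwards, `-1` if it crosses it downwards, and `0` otherwise. -/
def crossing (s a b : Square) : ℤ :=
  if a.1 = b.1 ∧ s.1 < a.1 then
    if a.2 = s.2 ∧ b.2 = s.2 + 1 then 1
    else if a.2 = s.2 + 1 ∧ b.2 = s.2 then -1
    else 0
  else 0

/-- The winding number, around the centre of the square `s`, of a closed path of squares not
passing through `s`: the number of signed crossings with a ray issuing from `s`. (The vertical
half-unit segment from the centre of `s` to the start of the ray meets no step of a path
that avoids `s`.) -/
def windingNumber {a : Square} (p : grid.Walk a a) (s : Square) : ℤ :=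
  (p.darts.map fun d => crossing s d.fst d.snd).sum

/-- No closed path of squares of `R` encircles a square outside `R` with nonzero winding number. -/
def IsSimplyConnected (R : Finset Square) : Prop :=
  ∀ s, s ∉ R → ∀ (a : Square) (p : grid.Walk a a), (∀ x ∈ p.support, x ∈ R) →
    windingNumber p s = 0

/-- A region is a finite set of squares which is connected through shared edges
(the empty set is allowed). -/
def IsRegion (R : Finset Square) : Prop :=
  (grid.induce (R : Set Square)).Preconnected

/-- The boundary squares of `R`: squares outside `R` adjacent to a square of `R`. -/
def boundary (R : Finset Square) : Set Square :=
  {b | b ∉ R ∧ ∃ s ∈ R, grid.Adj b s}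

/-! ### The relation `left of` -/

def DirectlyLeft (s s' : Square) : Prop :=
  level s = level s' ∧ s.1 < s'.1

def IndirectlyLeft (s s' : Square) : Prop :=
  |level s - level s'| = 1 ∧ s.1 ≤ s'.1 ∧ s'.2 ≤ s.2

def SquareLeft (s s' : Square) : Prop :=
  DirectlyLeft s s' ∨ IndirectlyLeft s s'

/-- The relation `≺` between tiles; a single square `s` is treated as the set `{s}`. -/
def LeftOf (A B : Finset Square) : Prop :=
  ∃ s ∈ A, ∃ s' ∈ B, SquareLeft s s'

/-! ### Ribbon tiles and tilings -/

/-- A ribbon tile of order `n`: a connected set of squares with exactly one square of each colour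
modulo `n`. -/
def IsRibbonTile (n : ℕ) (t : Finset Square) : Prop :=
  (grid.induce (t : Set Square)).Connected ∧
    ∀ c : ℤ, ∃! s : Square, s ∈ t ∧ level s ≡ c [ZMOD n]

/-- `c` is the level of the lowest square of `t`. -/
def HasLevel (t : Finset Square) (c : ℤ) : Prop :=
  IsLeast (level '' (t : Set Square)) c

/-- An order-`n` ribbon tiling of `R`. -/
@[ext]
structure Tiling (n : ℕ) (R : Finset Square) where
  tiles : Finset (Finset Square)
  isRibbonTile : ∀ t ∈ tiles, IsRibbonTile n t
  pairwiseDisjoint : ∀ t ∈ tiles, ∀ t' ∈ tiles, t ≠ t' → Disjoint t t'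
  covers : tiles.biUnion id = R

/-- Two tilings differ by a local replacement move: one is obtained from the other by removing a
pair `p` of tiles and adding another pair `q` in its place. -/
def LocalMove {n : ℕ} {R : Finset Square} (α β : Tiling n R) : Prop :=
  ∃ p q : Finset (Finset Square), p.card = 2 ∧ q.card = 2 ∧ p ≠ q ∧
    p ⊆ α.tiles ∧ q ⊆ β.tiles ∧ α.tiles \ p = β.tiles \ q

/-- `t` is the tile `t_{c,i}(α)`: the `i`-th tile of `α`, from left to right, of level `c`,
counting from `1`. -/
def IsTileAt {n : ℕ} {R : Finset Square} (α : Tiling n R) (c : ℤ) (i : ℕ)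
    (t : Finset Square) : Prop :=
  t ∈ α.tiles ∧ HasLevel t c ∧
    {t' | t' ∈ α.tiles ∧ HasLevel t' c ∧ t' ≠ t ∧ LeftOf t' t}.ncard + 1 = i

/-! ### Oriented and partially oriented graphs -/

/-- A directed graph with a vertex set inside `V`. -/
@[ext]
structure OrientedGraph (V : Type*) where
  verts : Set V
  Arc : V → V → Prop

/-- A graph with vertex set inside `V`, some of whose edges carry a direction. -/
structure PartiallyOrientedGraph (V : Type*) where
  verts : Set V
  Adj : V → V → Prop
  Arc : V → V → Prop

/-- `O` has no directed cycle. -/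
def OrientedGraph.IsAcyclic {V : Type*} (O : OrientedGraph V) : Prop :=
  ∀ v, ¬ Relation.TransGen O.Arc v v

/-- `O` is an orientation of the underlying graph of `G`: it has the same vertices and edges, and
each edge gets exactly one of its two directions. -/
def OrientedGraph.IsOrientationOf {V : Type*} (O : OrientedGraph V)
    (G : PartiallyOrientedGraph V) : Prop :=
  O.verts = G.verts ∧ (∀ v w, O.Arc v w → G.Adj v w) ∧
    ∀ v w, G.Adj v w → Xor (O.Arc v w) (O.Arc w v)

/-- `O` agrees with `G` on the edges already oriented in `G`. -/
def OrientedGraph.Extends {V : Type*} (O : OrientedGraph V)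
    (G : PartiallyOrientedGraph V) : Prop :=
  ∀ v w, G.Arc v w → O.Arc v w

/-- Two orientations differ by an edge reversal: they agree on all edges but exactly one. -/
def OrientedGraph.EdgeReversal {V : Type*} (A B : OrientedGraph V) : Prop :=
  ∃ v w, A.Arc v w ∧ B.Arc w v ∧ ¬ A.Arc w v ∧ ¬ B.Arc v w ∧
    ∀ x y, s(x, y) ≠ s(v, w) → (A.Arc x y ↔ B.Arc x y)

/-! ### The graphs `G_R(α)` and `G_R` -/

/-- Names of vertices: abstract tile vertices `t_{c,i}` and squares. -/
inductive GVertex : Type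
  | tile (c : ℤ) (i : ℕ) : GVertex
  | square (s : Square) : GVertex

/-- The set of squares `A` is the tile, or the single boundary square, that the vertex `v` stands
for in the tiling `α`. -/
def Represents {n : ℕ} {R : Finset Square} (α : Tiling n R) : GVertex → Finset Square → Prop
  | .tile c i, A => IsTileAt α c i A
  | .square s, A => s ∈ boundary R ∧ A = {s}

/-- The oriented graph `G_R(α)`. -/
def tilingGraph {n : ℕ} {R : Finset Square} (α : Tiling n R) : OrientedGraph GVertex where
  verts := {v | ∃ A, Represents α v A}
  Arc v w := v ≠ w ∧ ∃ A B, Represents α v A ∧ Represents α w B ∧ LeftOf A B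

/-- Pairs of vertices whose edge is forced: all except two tiles of different types. -/
def IsForcedPair (n : ℕ) : GVertex → GVertex → Prop
  | .tile c _, .tile d _ => c ≡ d [ZMOD n]
  | _, _ => True

/-- The partially oriented graph `G_R`: vertices and edges are those occurring in `G_R(α)` for some
tiling `α`, and the forced edges are directed as in `G_R(α)` for some tiling `α`. -/
def regionGraph (n : ℕ) (R : Finset Square) : PartiallyOrientedGraph GVertex where
  verts := {v | match v with
    | .square s => s ∈ boundary R
    | .tile c i => ∃ (α : Tiling n R) (t : Finset Square), IsTileAt α c i t}
  Adj v w := ∃ α : Tiling n R, (tilingGraph α).Arc v w ∨ (tilingGraph α).Arc w v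
  Arc v w := IsForcedPair n v w ∧ ∃ α : Tiling n R, (tilingGraph α).Arc v w

/-- The acyclic orientations of `G_R` that extend its partial orientation. -/
def acyclicExtensions (n : ℕ) (R : Finset Square) : Set (OrientedGraph GVertex) :=
  {O | O.IsOrientationOf (regionGraph n R) ∧ O.Extends (regionGraph n R) ∧ O.IsAcyclic}

end Ribbon

/-!
Draw the square `(x, y)` at height `x + y` (its level) and at horizontal position `x - y`. A ribbon
tile of order `n` becomes a strand: one square at each of `n` consecutive levels, consecutive
squares being adjacent; a single square is a strand too. Two squares whose levels differ by at most
one are comparable under `≺`, the order being that of their positions, and disjoint strands never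
cross (`IsStrand.pos_lt`). So two disjoint strands are comparable exactly when their levels overlap
or are contiguous, and in one direction only. The relation has no cycles: the strand ending lowest
can be cut out of any path (`LeftOf.shortcut`).

Simple connectedness enters only through `countRight_eq`: the number of tiles of level `c` to the
right of a square `s` outside `R` is the same in all tilings. Since paths in `R` do not wind
around `s`, the signed crossings of steps in `R` with the staircase to the right of `s` are the
differences of a function `φ` on the squares of `R`. The sum of `φ` over the squares of colour
`c - 1`, minus the sum over colour `c`, depends only on `R`. Grouped by tiles, it counts the
crossings by tiles whose lowest colour is `c`, less those crossings of the other tiles that pass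
from colour `c - 1` to colour `c`; suitable choices of the staircase isolate the tiles of level `c`.

Consequently all tilings have the same vertices and edges, and the edges between a tile and a
boundary square have the same directions in all of them. For `t_{c,i}` and `t_{c+n,j}` one uses that
on the staircase where the former ends and the latter begins, the two levels alternate, so that the
number of tiles of level `c` left of `t_{c+n,j}` is determined as well (`card_leftOf_eq`). This
gives `arc_of_isForcedPair`. The graph determines the tiling by an argument from left to right along
each level (`tilingGraph_injective`).

If a free edge `A ≺ B` has no tile or boundary square between its ends, then `A` and `B` occupy
neighbouring places on the two staircases that bound their common levels, so they can trade their
squares at the common levels (`exists_swap`). This reverses their edge and changes no other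
comparison (`IsExchange.edgeReversal`). An acyclic orientation extending the forced one and
differing from the graph of a tiling disagrees with it on an edge with nothing between its ends;
reversing such edges one after another leads to a tiling with the given graph. Conversely, if two
tiles are replaced by two others, the new ones cross over exactly at the two bounding staircases;
nothing lies between the tiles then, since a tile is too long and a boundary square would contradict
`countRight_eq`.
-/

namespace Ribbon

/-! ### Level and horizontal position -/

/-- The horizontal position `x - y` of the square `(x, y)`, when the levels are drawn as horizontal
lines. It has the parity of the level. -/
def pos (s : Square) : ℤ := s.1 - s.2

theorem eq_of_level_pos {s t : Square} (h : level s = level t) (h' : pos s = pos t) : s = t := by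
  simp only [level, pos] at h h'
  ext <;> omega

/-- Two squares whose levels differ by at most one. Any two such squares are comparable
under `SquareLeft`, unless they are equal. -/
def Near (s t : Square) : Prop := level s ≤ level t + 1 ∧ level t ≤ level s + 1

theorem Near.symm {s t : Square} (h : Near s t) : Near t s := ⟨h.2, h.1⟩

theorem near_of_level_eq {s t : Square} (h : level s = level t) : Near s t := by
  constructor <;> omega

theorem squareLeft_iff {s t : Square} : SquareLeft s t ↔ Near s t ∧ pos s < pos t := by
  simp only [SquareLeft, DirectlyLeft, IndirectlyLeft, Near, level, pos, abs_eq (zero_le_one' ℤ)]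
  omega

theorem grid_adj_iff {s t : Square} : grid.Adj s t ↔
    (level t = level s + 1 ∨ level s = level t + 1) ∧
      (pos t = pos s + 1 ∨ pos s = pos t + 1) := by
  change |s.1 - t.1| + |s.2 - t.2| = 1 ↔ _
  simp only [level, pos]
  rcases abs_cases (s.1 - t.1) with h | h <;> rcases abs_cases (s.2 - t.2) with h' | h' <;>
    omega

/-- The parity of `pos` is that of `level`, so near squares at equal position coincide. -/
theorem Near.eq_of_pos {s t : Square} (h : Near s t) (h' : pos s = pos t) : s = t := by
  obtain ⟨h1, h2⟩ := h
  refine eq_of_level_pos ?_ h'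
  simp only [level, pos] at *
  omega

theorem Near.pos_lt_or {s t : Square} (h : Near s t) (hne : s ≠ t) : pos s < pos t ∨ pos t < pos s :=
  lt_or_gt_of_ne fun h' => hne (h.eq_of_pos h')

/-- Every square `(level, pos)` of the right parity exists. -/
theorem exists_square {k p : ℤ} (h : (k - p) % 2 = 0) : ∃ s, level s = k ∧ pos s = p :=
  ⟨((k + p) / 2, (k - p) / 2), by simp only [level]; omega, by simp only [pos]; omega⟩

/-! ### Strands -/

/-- A strand on the levels `lo, …, hi`: one square at each of these levels, squares at consecutive
levels being adjacent. Ribbon tiles are strands of `n` squares, and a single square is a strand. -/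
structure IsStrand (lo hi : ℤ) (A : Finset Square) : Prop where
  bounds : ∀ s ∈ A, lo ≤ level s ∧ level s ≤ hi
  exists_mem : ∀ k, lo ≤ k → k ≤ hi → ∃ s ∈ A, level s = k
  unique : ∀ s ∈ A, ∀ t ∈ A, level s = level t → s = t
  step : ∀ s ∈ A, ∀ t ∈ A, level t = level s + 1 → pos t = pos s + 1 ∨ pos s = pos t + 1

theorem isStrand_singleton (s : Square) : IsStrand (level s) (level s) {s} where
  bounds := by simp
  exists_mem k h h' := ⟨s, by simp, le_antisymm h h'⟩
  unique := by simp
  step := by simp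

theorem pos_lt_of_step {p q q' : Square} (h : pos p < pos q) (hn : Near p q')
    (hq : pos q' = pos q + 1 ∨ pos q = pos q' + 1) (hne : p ≠ q') : pos p < pos q' := by
  have := mt hn.eq_of_pos hne
  omega

theorem lt_pos_of_step {p p' q : Square} (h : pos p < pos q) (hn : Near p' q)
    (hq : pos p' = pos p + 1 ∨ pos p = pos p' + 1) (hne : p' ≠ q) : pos p' < pos q := by
  have := mt hn.eq_of_pos hne
  omega

/-- Disjoint strands do not cross: if some pair of near squares of `A` and `B` is ordered from `A`
to `B`, then so is every such pair. -/
theorem IsStrand.pos_lt {a₁ a₂ b₁ b₂ : ℤ} {A B : Finset Square} (hA : IsStrand a₁ a₂ A)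
    (hB : IsStrand b₁ b₂ B) (hd : Disjoint A B) {s s' t t' : Square} (hs : s ∈ A) (hs' : s' ∈ A)
    (ht : t ∈ B) (ht' : t' ∈ B) (hn : Near s t) (hn' : Near s' t') (h : pos s < pos t) :
    pos s' < pos t' := by
  have hne : ∀ x ∈ A, ∀ y ∈ B, x ≠ y := fun x hx y hy e =>
    Finset.disjoint_left.1 hd hx (e ▸ hy)
  -- Walk from `(s, t)` to `(s', t')` through near pairs, changing one square by one level at a time.
  induction hm : ((level s' - level s).natAbs + (level t' - level t).natAbs) using
    Nat.strong_induction_on generalizing s t with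
  | _ m ih =>
    subst hm
    have bs := hA.bounds s hs
    have bs' := hA.bounds s' hs'
    have bt := hB.bounds t ht
    have bt' := hB.bounds t' ht'
    have moveS : ∀ k, (k = level s + 1 ∨ level s = k + 1) → a₁ ≤ k → k ≤ a₂ →
        k ≤ level t + 1 → level t ≤ k + 1 →
        (level s' - k).natAbs < (level s' - level s).natAbs → pos s' < pos t' := by
      intro k hk h1 h2 h3 h4 h5
      obtain ⟨r, hr, rfl⟩ := hA.exists_mem k h1 h2
      have hnr : Near r t := ⟨h3, h4⟩
      refine ih _ (by omega) hr ht hnr ?_ rfl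
      refine lt_pos_of_step h hnr ?_ (hne r hr t ht)
      rcases hk with hk | hk
      · exact hA.step s hs r hr hk
      · exact (hA.step r hr s hs hk).symm
    have moveT : ∀ k, (k = level t + 1 ∨ level t = k + 1) → b₁ ≤ k → k ≤ b₂ →
        level s ≤ k + 1 → k ≤ level s + 1 →
        (level t' - k).natAbs < (level t' - level t).natAbs → pos s' < pos t' := by
      intro k hk h1 h2 h3 h4 h5
      obtain ⟨r, hr, rfl⟩ := hB.exists_mem k h1 h2
      have hnr : Near s r := ⟨h3, h4⟩
      refine ih _ (by omega) hs hr hnr ?_ rfl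
      refine pos_lt_of_step h hnr ?_ (hne s hs r hr)
      rcases hk with hk | hk
      · exact hB.step t ht r hr hk
      · exact (hB.step r hr t ht hk).symm
    obtain ⟨n1, n2⟩ := hn
    obtain ⟨n1', n2'⟩ := hn'
    rcases lt_trichotomy (level s) (level s') with c | c | c
    · by_cases c' : level s ≤ level t
      · exact moveS (level s + 1) (by omega) (by omega) (by omega) (by omega) (by omega) (by omega)
      · exact moveT (level t + 1) (by omega) (by omega) (by omega) (by omega) (by omega) (by omega)
    · rcases lt_trichotomy (level t) (level t') with d | d | d
      · exact moveT (level t + 1) (by omega) (by omega) (by omega) (by omega) (by omega) (by omega)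
      · rwa [← hA.unique s hs s' hs' c, ← hB.unique t ht t' ht' d]
      · exact moveT (level t - 1) (by omega) (by omega) (by omega) (by omega) (by omega) (by omega)
    · by_cases c' : level t ≤ level s
      · exact moveS (level s - 1) (by omega) (by omega) (by omega) (by omega) (by omega) (by omega)
      · exact moveT (level t - 1) (by omega) (by omega) (by omega) (by omega) (by omega) (by omega)

theorem leftOf_iff {A B : Finset Square} :
    LeftOf A B ↔ ∃ s ∈ A, ∃ t ∈ B, Near s t ∧ pos s < pos t := by
  simp only [LeftOf, squareLeft_iff]

theorem LeftOf.pos_lt {a₁ a₂ b₁ b₂ : ℤ} {A B : Finset Square} (h : LeftOf A B)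
    (hA : IsStrand a₁ a₂ A) (hB : IsStrand b₁ b₂ B) (hd : Disjoint A B) {s t : Square}
    (hs : s ∈ A) (ht : t ∈ B) (hn : Near s t) : pos s < pos t := by
  obtain ⟨s', hs', t', ht', hn', hlt⟩ := leftOf_iff.1 h
  exact hA.pos_lt hB hd hs' hs ht' ht hn' hn hlt

theorem LeftOf.asymm {a₁ a₂ b₁ b₂ : ℤ} {A B : Finset Square} (h : LeftOf A B)
    (hA : IsStrand a₁ a₂ A) (hB : IsStrand b₁ b₂ B) (hd : Disjoint A B) : ¬ LeftOf B A := by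
  intro h'
  obtain ⟨s', hs', t', ht', hn', hlt⟩ := leftOf_iff.1 h'
  exact absurd (h.pos_lt hA hB hd ht' hs' hn'.symm) (by omega)

theorem leftOf_of_pos_lt {A B : Finset Square} {s t : Square} (hs : s ∈ A) (ht : t ∈ B)
    (hn : Near s t) (h : pos s < pos t) : LeftOf A B :=
  leftOf_iff.2 ⟨s, hs, t, ht, hn, h⟩

/-- Strands whose ranges of levels overlap or are contiguous contain near squares. -/
theorem IsStrand.exists_near {a₁ a₂ b₁ b₂ : ℤ} {A B : Finset Square} (hA : IsStrand a₁ a₂ A)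
    (hB : IsStrand b₁ b₂ B) (ha : a₁ ≤ a₂) (hb : b₁ ≤ b₂) (h : a₁ ≤ b₂ + 1) (h' : b₁ ≤ a₂ + 1) :
    ∃ s ∈ A, ∃ t ∈ B, Near s t := by
  obtain ⟨s, hs, es⟩ := hA.exists_mem (if a₁ ≤ b₁ then min a₂ b₁ else a₁)
    (by split_ifs <;> omega) (by split_ifs <;> omega)
  obtain ⟨t, ht, et⟩ := hB.exists_mem (if a₁ ≤ b₁ then b₁ else min b₂ a₁)
    (by split_ifs <;> omega) (by split_ifs <;> omega)
  exact ⟨s, hs, t, ht, by unfold Near; split_ifs at es et <;> omega⟩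

theorem LeftOf.bounds {a₁ a₂ b₁ b₂ : ℤ} {A B : Finset Square} (h : LeftOf A B)
    (hA : IsStrand a₁ a₂ A) (hB : IsStrand b₁ b₂ B) : a₁ ≤ b₂ + 1 ∧ b₁ ≤ a₂ + 1 := by
  obtain ⟨s, hs, t, ht, ⟨h1, h2⟩, -⟩ := leftOf_iff.1 h
  have := hA.bounds s hs
  have := hB.bounds t ht
  omega

theorem leftOf_or {A B : Finset Square} (hd : Disjoint A B) {s t : Square} (hs : s ∈ A) (ht : t ∈ B)
    (hn : Near s t) : LeftOf A B ∨ LeftOf B A := by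
  have hne : s ≠ t := fun e => Finset.disjoint_left.1 hd hs (e ▸ ht)
  rcases hn.pos_lt_or hne with h | h
  · exact .inl (leftOf_of_pos_lt hs ht hn h)
  · exact .inr (leftOf_of_pos_lt ht hs hn.symm h)

/-! ### Disjoint strands are acyclically ordered -/

/-- A set of pairwise disjoint, nonempty strands. -/
structure IsStrandFamily (F : Set (Finset Square)) : Prop where
  isStrand : ∀ A ∈ F, ∃ lo hi, lo ≤ hi ∧ IsStrand lo hi A
  disjoint : ∀ A ∈ F, ∀ B ∈ F, A ≠ B → Disjoint A B

/-- The relation `≺` on distinct members of `F`. (A tile of more than one square is `≺` itself, so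
equal members have to be excluded.) -/
def FamilyRel (F : Set (Finset Square)) (A B : Finset Square) : Prop :=
  A ∈ F ∧ B ∈ F ∧ A ≠ B ∧ LeftOf A B

/-- If `A` ends lowest among three disjoint strands, then `P ≺ A ≺ Q` gives `P ≺ Q`, because both
`P` and `Q` meet the top level of `A` or the level above it. -/
theorem LeftOf.shortcut {a₁ a₂ p₁ p₂ q₁ q₂ : ℤ} {A P Q : Finset Square}
    (hA : IsStrand a₁ a₂ A) (hP : IsStrand p₁ p₂ P) (hQ : IsStrand q₁ q₂ Q)
    (ha : a₁ ≤ a₂) (hPA : Disjoint P A) (hAQ : Disjoint A Q)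
    (hp : a₂ ≤ p₂) (hq : a₂ ≤ q₂) (hp' : p₁ ≤ p₂) (hq' : q₁ ≤ q₂)
    (h : LeftOf P A) (h' : LeftOf A Q) : LeftOf P Q := by
  have b := h.bounds hP hA
  have b' := h'.bounds hA hQ
  obtain ⟨a, hmem, ea⟩ := hA.exists_mem a₂ ha le_rfl
  obtain ⟨p, hpm, ep⟩ := hP.exists_mem (max p₁ a₂) (by omega) (by omega)
  obtain ⟨q, hqm, eq⟩ := hQ.exists_mem (max q₁ a₂) (by omega) (by omega)
  have h1 := h.pos_lt hP hA hPA hpm hmem (by unfold Near; omega)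
  have h2 := h'.pos_lt hA hQ hAQ hmem hqm (by unfold Near; omega)
  exact leftOf_of_pos_lt hpm hqm (by unfold Near; omega) (h1.trans h2)

theorem IsStrandFamily.acyclic_of_finset (F : Finset (Finset Square)) :
    IsStrandFamily (F : Set (Finset Square)) →
      ∀ A, ¬ Relation.TransGen (FamilyRel (F : Set (Finset Square))) A A := by
  classical
  induction hm : F.card generalizing F with
  | zero =>
    intro hF A h
    obtain ⟨B, hB, -⟩ := Relation.TransGen.head'_iff.1 h
    rw [Finset.card_eq_zero.1 hm] at hB
    exact absurd hB.1 (by simp)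
  | succ m ih =>
    intro hF
    have key : ∀ A : F, ∃ hi lo, lo ≤ hi ∧ IsStrand lo hi A.1 := fun A => by
      obtain ⟨lo, hi, h⟩ := hF.isStrand A.1 A.2
      exact ⟨hi, lo, h⟩
    choose hi lo hle hst using key
    have hne : F.attach.Nonempty := by
      rw [Finset.attach_nonempty_iff, ← Finset.card_pos]; omega
    obtain ⟨⟨T, hT⟩, -, hmin⟩ := F.attach.exists_min_image hi hne
    have hF' : IsStrandFamily ((F.erase T : Finset _) : Set (Finset Square)) :=
      ⟨fun A hA => hF.isStrand A (Finset.mem_of_mem_erase hA), fun A hA B hB =>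
        hF.disjoint A (Finset.mem_of_mem_erase hA) B (Finset.mem_of_mem_erase hB)⟩
    have ih' := ih (F.erase T) (by rw [Finset.card_erase_of_mem hT]; omega) hF'
    have restrict : ∀ {A B}, FamilyRel (F : Set (Finset Square)) A B → A ≠ T → B ≠ T →
        FamilyRel ((F.erase T : Finset _) : Set (Finset Square)) A B := by
      intro A B h hA hB
      exact ⟨by simpa using ⟨h.1, hA⟩, by simpa using ⟨h.2.1, hB⟩, h.2.2⟩
    -- A path between members other than `T` can be rerouted to avoid `T`.
    have avoid : ∀ A B, Relation.TransGen (FamilyRel (F : Set (Finset Square))) A B → A ≠ T →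
        (B ≠ T → Relation.TransGen
          (FamilyRel ((F.erase T : Finset _) : Set (Finset Square))) A B) ∧
        (B = T → ∃ P, P ≠ T ∧ FamilyRel (F : Set (Finset Square)) P T ∧
          (A = P ∨ Relation.TransGen
            (FamilyRel ((F.erase T : Finset _) : Set (Finset Square))) A P)) := by
      intro A B h hA
      induction h with
      | single h =>
        exact ⟨fun hB => .single (restrict h hA hB), fun hB => ⟨A, hA, hB ▸ h, .inl rfl⟩⟩
      | @tail B C _ hBC ihB =>
        by_cases hB : B = T
        · subst hB
          refine ⟨fun hC => ?_, fun hC => absurd hC.symm hBC.2.2.1⟩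
          obtain ⟨P, hP, hPT, hAP⟩ := ihB.2 rfl
          by_cases hPC : P = C
          · -- `P ≺ T ≺ P` is impossible for disjoint strands.
            subst hPC
            exact absurd hBC.2.2.2 (hPT.2.2.2.asymm (hst ⟨P, hPT.1⟩) (hst ⟨B, hT⟩)
              (hF.disjoint _ hPT.1 _ hT hP))
          · have hl : LeftOf P C := LeftOf.shortcut (hst ⟨B, hT⟩) (hst ⟨P, hPT.1⟩)
              (hst ⟨C, hBC.2.1⟩) (hle _) (hF.disjoint _ hPT.1 _ hT hP)
              (hF.disjoint _ hT _ hBC.2.1 hBC.2.2.1) (hmin _ (Finset.mem_attach _ _))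
              (hmin _ (Finset.mem_attach _ _)) (hle _) (hle _) hPT.2.2.2 hBC.2.2.2
            have hr := restrict ⟨hPT.1, hBC.2.1, hPC, hl⟩ hP hC
            rcases hAP with rfl | hAP
            · exact .single hr
            · exact hAP.tail hr
        · refine ⟨fun hC => (ihB.1 hB).tail (restrict hBC hB hC), fun hC => ?_⟩
          subst hC
          exact ⟨B, hB, hBC, .inr (ihB.1 hB)⟩
    intro A h
    by_cases hA : A = T
    · subst hA
      obtain ⟨B, hAB, hBA⟩ := Relation.TransGen.head'_iff.1 h
      have hB : B ≠ A := hAB.2.2.1.symm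
      have hBB : Relation.TransGen (FamilyRel (F : Set (Finset Square))) B B :=
        Relation.TransGen.tail' hBA hAB
      exact ih' B ((avoid B B hBB hB).1 hB)
    · exact ih' A ((avoid A A h hA).1 hA)

theorem IsStrandFamily.acyclic {F : Set (Finset Square)} (hF : IsStrandFamily F)
    (hfin : F.Finite) (A : Finset Square) : ¬ Relation.TransGen (FamilyRel F) A A := by
  have := IsStrandFamily.acyclic_of_finset hfin.toFinset (by simpa using hF) A
  simpa using this

/-! ### Ribbon tiles are strands -/

/-- Along a connected set, every change of a property happens across some adjacent pair. -/
theorem exists_adj_of_connected {t : Finset Square}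
    (h : (grid.induce (t : Set Square)).Preconnected) {P : Square → Prop} {a b : Square}
    (ha : a ∈ t) (hb : b ∈ t) (hPa : P a) (hPb : ¬ P b) :
    ∃ x ∈ t, ∃ y ∈ t, grid.Adj x y ∧ P x ∧ ¬ P y := by
  obtain ⟨p⟩ := h ⟨a, ha⟩ ⟨b, hb⟩
  obtain ⟨d, -, h1, h2⟩ := p.exists_boundary_dart {x | P x.1} hPa hPb
  exact ⟨d.fst.1, d.fst.2, d.snd.1, d.snd.2, d.adj, h1, h2⟩

theorem IsRibbonTile.exists_isStrand {n : ℕ} (hn : 1 ≤ n) {t : Finset Square}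
    (h : IsRibbonTile n t) : ∃ c, IsStrand c (c + n - 1) t := by
  obtain ⟨hconn, hcol⟩ := h
  obtain ⟨⟨a, ha⟩⟩ := hconn.nonempty
  obtain ⟨m, hm, hmin⟩ := t.exists_min_image level ⟨a, ha⟩
  have uniq : ∀ s ∈ t, ∀ s' ∈ t, level s ≡ level s' [ZMOD n] → s = s' := fun s hs s' hs' e =>
    (hcol (level s')).unique ⟨hs, e⟩ ⟨hs', rfl⟩
  have upper : ∀ s ∈ t, level s < level m + n := by
    intro s hs
    by_contra hlt
    obtain ⟨x, hx, y, hy, hadj, h1, h2⟩ := exists_adj_of_connected hconn.preconnected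
      (P := fun s => level s < level m + n) hm hs (by omega) hlt
    have hy' : level y = level m + n := by
      have := (grid_adj_iff.1 hadj).1
      omega
    have := uniq y hy m hm (by rw [hy']; simp [Int.ModEq])
    subst this
    omega
  refine ⟨level m, fun s hs => ⟨hmin s hs, by have := upper s hs; omega⟩, ?_,
    fun s hs s' hs' e => uniq s hs s' hs' (by rw [e]), ?_⟩
  · intro k h1 h2
    obtain ⟨s, ⟨hs, hsk⟩, -⟩ := hcol k
    refine ⟨s, hs, ?_⟩
    have b1 := hmin s hs
    have b2 := upper s hs
    obtain ⟨z, hz⟩ := hsk.dvd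
    have : z = 0 := by
      have hn' : (0 : ℤ) < n := by omega
      have l1 : z < 1 := by by_contra; nlinarith
      have l2 : -1 < z := by by_contra; nlinarith
      omega
    subst this
    omega
  · intro s hs s' hs' e
    obtain ⟨x, hx, y, hy, hadj, h1, h2⟩ := exists_adj_of_connected hconn.preconnected
      (P := fun r => level r ≤ level s) hs hs' le_rfl (by omega)
    have hadj' := grid_adj_iff.1 hadj
    have ex : x = s := uniq x hx s hs (by rw [show level x = level s by omega])
    have ey : y = s' := uniq y hy s' hs' (by rw [show level y = level s' by omega])
    subst ex ey
    exact hadj'.2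

theorem IsStrand.isRibbonTile {n : ℕ} (hn : 1 ≤ n) {c : ℤ} {t : Finset Square}
    (h : IsStrand c (c + n - 1) t) : IsRibbonTile n t := by
  obtain ⟨b, hb, eb⟩ := h.exists_mem c le_rfl (by omega)
  refine ⟨?_, fun k => ?_⟩
  · have reach : ∀ m : ℕ, ∀ s (hs : s ∈ t), level s = c + m →
        (grid.induce (t : Set Square)).Reachable ⟨b, hb⟩ ⟨s, hs⟩ := by
      intro m
      induction m with
      | zero =>
        intro s hs e
        have : b = s := h.unique b hb s hs (by rw [eb, e]; simp)
        subst this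
        rfl
      | succ m ih =>
        intro s hs e
        have bs := h.bounds s hs
        obtain ⟨r, hr, er⟩ := h.exists_mem (c + m) (by omega) (by push_cast at e; omega)
        have hl : level s = level r + 1 := by rw [er, e]; push_cast; ring
        refine (ih r hr er).trans (SimpleGraph.Adj.reachable ?_)
        exact grid_adj_iff.2 ⟨.inl hl, h.step r hr s hs hl⟩
    have : Nonempty (t : Set Square) := ⟨⟨b, hb⟩⟩
    refine ⟨fun x y => ?_⟩
    have hx := h.bounds x.1 x.2
    have hy := h.bounds y.1 y.2
    exact (reach (level x.1 - c).toNat x.1 x.2 (by omega)).symm.trans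
      (reach (level y.1 - c).toNat y.1 y.2 (by omega))
  · have hn' : (0 : ℤ) < n := by omega
    have m1 := Int.emod_nonneg (k - c) hn'.ne'
    have m2 := Int.emod_lt_of_pos (k - c) hn'
    obtain ⟨s, hs, es⟩ := h.exists_mem (c + (k - c) % n) (by omega) (by omega)
    have hmod : ∀ y ∈ t, level y ≡ k [ZMOD n] → level y = c + (k - c) % n := by
      intro y hy e
      have by' := h.bounds y hy
      have : (level y - c) % n = (k - c) % n := (e.sub_right c)
      rw [Int.emod_eq_of_lt (by omega) (by omega)] at this
      omega
    refine ⟨s, ⟨hs, ?_⟩, fun y hy => h.unique y hy.1 s hs ?_⟩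
    · rw [es]
      calc c + (k - c) % n ≡ c + (k - c) [ZMOD n] := (Int.mod_modEq _ _).add_left c
        _ = k := by ring
    · rw [es, hmod y hy.1 hy.2]

theorem IsStrand.hasLevel_iff {a b c : ℤ} {t : Finset Square} (h : IsStrand a b t) (hab : a ≤ b) :
    HasLevel t c ↔ c = a := by
  obtain ⟨s, hs, es⟩ := h.exists_mem a le_rfl hab
  have : IsLeast (level '' (t : Set Square)) a :=
    ⟨⟨s, hs, es⟩, by rintro _ ⟨r, hr, rfl⟩; exact (h.bounds r hr).1⟩
  exact ⟨fun hc => hc.unique this, fun hc => hc ▸ this⟩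

theorem HasLevel.isStrand {n : ℕ} (hn : 1 ≤ n) {t : Finset Square} {c : ℤ} (hc : HasLevel t c)
    (h : IsRibbonTile n t) : IsStrand c (c + n - 1) t := by
  obtain ⟨d, hd⟩ := h.exists_isStrand hn
  rwa [(hd.hasLevel_iff (by omega)).1 hc]

theorem IsRibbonTile.exists_hasLevel {n : ℕ} (hn : 1 ≤ n) {t : Finset Square}
    (h : IsRibbonTile n t) : ∃ c, HasLevel t c := by
  obtain ⟨d, hd⟩ := h.exists_isStrand hn
  exact ⟨d, (hd.hasLevel_iff (by omega)).2 rfl⟩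

open Classical in
/-- The square of `A` at level `k`, if there is one. -/
noncomputable def squareAt (A : Finset Square) (k : ℤ) : Square :=
  if h : ∃ s ∈ A, level s = k then h.choose else default

theorem IsStrand.squareAt_mem {a b k : ℤ} {A : Finset Square} (h : IsStrand a b A) (h1 : a ≤ k)
    (h2 : k ≤ b) : squareAt A k ∈ A := by
  have := h.exists_mem k h1 h2
  rw [squareAt, dif_pos this]
  exact this.choose_spec.1

theorem IsStrand.level_squareAt {a b k : ℤ} {A : Finset Square} (h : IsStrand a b A) (h1 : a ≤ k)
    (h2 : k ≤ b) : level (squareAt A k) = k := by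
  have := h.exists_mem k h1 h2
  rw [squareAt, dif_pos this]
  exact this.choose_spec.2

theorem IsStrand.squareAt_eq {a b : ℤ} {A : Finset Square} (h : IsStrand a b A) {s : Square}
    (hs : s ∈ A) : squareAt A (level s) = s := by
  have hb := h.bounds s hs
  exact h.unique _ (h.squareAt_mem hb.1 hb.2) _ hs (h.level_squareAt hb.1 hb.2)

/-- A sum over the squares of a strand at a given level has at most one term. -/
theorem IsStrand.sum_level {a b k : ℤ} {A : Finset Square} (h : IsStrand a b A) (f : Square → ℤ) :
    ∑ s ∈ A, (if level s = k then f s else 0) =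
      if a ≤ k ∧ k ≤ b then f (squareAt A k) else 0 := by
  split_ifs with hk
  · rw [Finset.sum_eq_single (squareAt A k), if_pos (h.level_squareAt hk.1 hk.2)]
    · intro s hs hne
      refine if_neg fun e => hne ?_
      rw [← e, h.squareAt_eq hs]
    · exact fun hn => absurd (h.squareAt_mem hk.1 hk.2) hn
  · refine Finset.sum_eq_zero fun s hs => if_neg ?_
    rintro rfl
    exact hk (h.bounds s hs)

/-! ### Ranks in a finite linear order -/

/-- The rank of `t`, counted from `1`, among the elements of `L` ordered by an integer key. -/
def rankIn {β : Type*} (L : Finset β) (key : β → ℤ) (t : β) : ℕ :=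
  (L.filter fun t' => key t' < key t).card + 1

theorem rankIn_lt_iff {β : Type*} {L : Finset β} {key : β → ℤ} {t t' : β} (ht : t ∈ L) :
    rankIn L key t < rankIn L key t' ↔ key t < key t' := by
  have mono : ∀ x y, key x ≤ key y → rankIn L key x ≤ rankIn L key y := fun x y h =>
    Nat.succ_le_succ (Finset.card_le_card fun z hz => by
      rw [Finset.mem_filter] at hz ⊢
      exact ⟨hz.1, hz.2.trans_le h⟩)
  refine ⟨fun h => ?_, fun h => ?_⟩
  · by_contra hlt
    exact absurd (mono t' t (by omega)) (by omega)
  · refine Nat.succ_lt_succ (Finset.card_lt_card (Finset.ssubset_iff_of_subset ?_ |>.2 ⟨t, ?_⟩))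
    · intro z hz
      rw [Finset.mem_filter] at hz ⊢
      exact ⟨hz.1, hz.2.trans h⟩
    · simp [ht, h]

theorem rankIn_inj {β : Type*} {L : Finset β} {key : β → ℤ} (hk : Set.InjOn key L) {t t' : β}
    (ht : t ∈ L) (ht' : t' ∈ L) (h : rankIn L key t = rankIn L key t') : t = t' := by
  refine hk ht ht' ?_
  have h1 := rankIn_lt_iff (key := key) (t' := t') ht
  have h2 := rankIn_lt_iff (key := key) (t' := t) ht'
  omega

theorem rankIn_mem {β : Type*} {L : Finset β} {key : β → ℤ} {t : β} (ht : t ∈ L) :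
    rankIn L key t ∈ Finset.Icc 1 L.card := by
  rw [Finset.mem_Icc]
  refine ⟨by simp [rankIn], Finset.card_lt_card (Finset.filter_ssubset.2 ⟨t, ht, by simp⟩)⟩

theorem exists_rankIn_eq {β : Type*} {L : Finset β} {key : β → ℤ} (hk : Set.InjOn key L) {i : ℕ}
    (hi : 1 ≤ i) (hi' : i ≤ L.card) : ∃ t ∈ L, rankIn L key t = i := by
  obtain ⟨t, ht, e⟩ := Finset.surj_on_of_inj_on_of_card_le (s := L) (t := Finset.Icc 1 L.card)
    (fun t _ => rankIn L key t) (fun t ht => rankIn_mem ht)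
    (fun a b ha hb h => rankIn_inj hk ha hb h) (by simp) i (Finset.mem_Icc.2 ⟨hi, hi'⟩)
  exact ⟨t, ht, e.symm⟩

/-- A property that holds on an initial segment holds exactly for the ranks up to the number of
elements having it. -/
theorem rankIn_le_card_iff {β : Type*} {L : Finset β} {key : β → ℤ} {P : β → Prop}
    [DecidablePred P] (hP : ∀ x ∈ L, ∀ y ∈ L, key x ≤ key y → P y → P x) {t : β} (ht : t ∈ L) :
    P t ↔ rankIn L key t ≤ (L.filter P).card := by
  constructor
  · intro h
    refine Finset.card_lt_card (Finset.ssubset_iff_of_subset ?_ |>.2 ⟨t, by simp [ht, h], by simp⟩)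
    intro z hz
    rw [Finset.mem_filter] at hz ⊢
    exact ⟨hz.1, hP z hz.1 t ht hz.2.le h⟩
  · intro h
    by_contra hn
    refine absurd (Finset.card_le_card (s := L.filter P)
      (t := L.filter fun t' => key t' < key t) ?_) (by unfold rankIn at h; omega)
    intro z hz
    rw [Finset.mem_filter] at hz ⊢
    refine ⟨hz.1, ?_⟩
    by_contra hlt
    exact hn (hP t ht z hz.1 (by omega) hz.2)

/-! ### Tilings and the vertices of their graphs -/

section
variable {n : ℕ} {R : Finset Square}

theorem Tiling.mem_region (α : Tiling n R) {t : Finset Square} (ht : t ∈ α.tiles) {s : Square}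
    (hs : s ∈ t) : s ∈ R := by
  rw [← α.covers]
  exact Finset.mem_biUnion.2 ⟨t, ht, hs⟩

theorem Tiling.exists_mem (α : Tiling n R) {s : Square} (hs : s ∈ R) : ∃ t ∈ α.tiles, s ∈ t := by
  rw [← α.covers] at hs
  exact Finset.mem_biUnion.1 hs

theorem Tiling.sum_eq (α : Tiling n R) (f : Square → ℤ) :
    ∑ s ∈ R, f s = ∑ t ∈ α.tiles, ∑ s ∈ t, f s := by
  conv_lhs => rw [← α.covers]
  rw [Finset.sum_biUnion]
  · rfl
  · intro t ht t' ht' hne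
    exact α.pairwiseDisjoint t ht t' ht' hne

open Classical in
/-- The tiles of level `c`. -/
noncomputable def Tiling.levelTiles (α : Tiling n R) (c : ℤ) : Finset (Finset Square) :=
  α.tiles.filter fun t => HasLevel t c

theorem Tiling.mem_levelTiles {α : Tiling n R} {c : ℤ} {t : Finset Square} :
    t ∈ α.levelTiles c ↔ t ∈ α.tiles ∧ HasLevel t c := by
  simp [Tiling.levelTiles]

theorem Tiling.isStrand (hn : 1 ≤ n) (α : Tiling n R) {t : Finset Square} {c : ℤ}
    (ht : t ∈ α.levelTiles c) : IsStrand c (c + n - 1) t :=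
  (mem_levelTiles.1 ht).2.isStrand hn (α.isRibbonTile t (mem_levelTiles.1 ht).1)

theorem Tiling.exists_levelTiles (hn : 1 ≤ n) (α : Tiling n R) {t : Finset Square}
    (ht : t ∈ α.tiles) : ∃ c, t ∈ α.levelTiles c := by
  obtain ⟨c, hc⟩ := (α.isRibbonTile t ht).exists_hasLevel hn
  exact ⟨c, mem_levelTiles.2 ⟨ht, hc⟩⟩

/-- The key ordering the tiles of level `c` from left to right: the position of the lowest
square. -/
noncomputable def basePos (c : ℤ) (t : Finset Square) : ℤ := pos (squareAt t c)

theorem Tiling.leftOf_iff_basePos (hn : 1 ≤ n) (α : Tiling n R) {c : ℤ} {t t' : Finset Square}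
    (ht : t ∈ α.levelTiles c) (ht' : t' ∈ α.levelTiles c) (hne : t ≠ t') :
    LeftOf t t' ↔ basePos c t < basePos c t' := by
  have hs := α.isStrand hn ht
  have hs' := α.isStrand hn ht'
  have hd := α.pairwiseDisjoint t (mem_levelTiles.1 ht).1 t' (mem_levelTiles.1 ht').1 hne
  have m := hs.squareAt_mem le_rfl (by omega)
  have m' := hs'.squareAt_mem le_rfl (by omega)
  have hnear : Near (squareAt t c) (squareAt t' c) := near_of_level_eq
    (by rw [hs.level_squareAt le_rfl (by omega), hs'.level_squareAt le_rfl (by omega)])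
  exact ⟨fun h => h.pos_lt hs hs' hd m m' hnear, fun h => leftOf_of_pos_lt m m' hnear h⟩

theorem Tiling.basePos_injOn (hn : 1 ≤ n) (α : Tiling n R) (c : ℤ) :
    Set.InjOn (basePos c) (α.levelTiles c) := by
  intro t ht t' ht' h
  by_contra hne
  have hs := α.isStrand hn ht
  have hs' := α.isStrand hn ht'
  have hd := α.pairwiseDisjoint t (mem_levelTiles.1 ht).1 t' (mem_levelTiles.1 ht').1 hne
  have e : squareAt t c = squareAt t' c := eq_of_level_pos
    (by rw [hs.level_squareAt le_rfl (by omega), hs'.level_squareAt le_rfl (by omega)]) h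
  exact Finset.disjoint_left.1 hd (hs.squareAt_mem le_rfl (by omega))
    (e ▸ hs'.squareAt_mem le_rfl (by omega))

theorem isTileAt_iff (hn : 1 ≤ n) {α : Tiling n R} {c : ℤ} {i : ℕ} {t : Finset Square} :
    IsTileAt α c i t ↔
      t ∈ α.levelTiles c ∧ rankIn (α.levelTiles c) (basePos c) t = i := by
  rw [IsTileAt, ← and_assoc, ← Tiling.mem_levelTiles]
  refine and_congr_right fun ht => ?_
  suffices h : {t' | t' ∈ α.tiles ∧ HasLevel t' c ∧ t' ≠ t ∧ LeftOf t' t} =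
      ((α.levelTiles c).filter fun t' => basePos c t' < basePos c t : Finset _) by
    rw [h, Set.ncard_coe_finset, rankIn]
  ext t'
  simp only [Set.mem_ofPred_eq, Finset.coe_filter]
  rw [← and_assoc, ← Tiling.mem_levelTiles]
  refine and_congr_right fun ht' => ?_
  constructor
  · exact fun h => (α.leftOf_iff_basePos hn ht' ht h.1).1 h.2
  · intro h
    have hne : t' ≠ t := by rintro rfl; exact lt_irrefl _ h
    exact ⟨hne, (α.leftOf_iff_basePos hn ht' ht hne).2 h⟩

/-- The lowest level of the object named by a vertex. -/
def GVertex.lo : GVertex → ℤ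
  | .tile c _ => c
  | .square s => level s

/-- The highest level of the object named by a vertex. -/
def GVertex.hi (n : ℕ) : GVertex → ℤ
  | .tile c _ => c + n - 1
  | .square s => level s

theorem GVertex.lo_le_hi (hn : 1 ≤ n) (v : GVertex) : v.lo ≤ v.hi n := by
  cases v <;> simp only [lo, hi] <;> omega

theorem Represents.isStrand (hn : 1 ≤ n) {α : Tiling n R} {v : GVertex} {A : Finset Square}
    (h : Represents α v A) : IsStrand v.lo (v.hi n) A := by
  cases v with
  | tile c i => exact α.isStrand hn ((isTileAt_iff hn).1 h).1
  | square s => obtain ⟨-, rfl⟩ := h; exact isStrand_singleton s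

theorem Represents.unique (hn : 1 ≤ n) {α : Tiling n R} {v : GVertex} {A B : Finset Square}
    (h : Represents α v A) (h' : Represents α v B) : A = B := by
  cases v with
  | tile c i =>
    obtain ⟨h1, h2⟩ := (isTileAt_iff hn).1 h
    obtain ⟨h1', h2'⟩ := (isTileAt_iff hn).1 h'
    exact rankIn_inj (α.basePos_injOn hn c) h1 h1' (h2.trans h2'.symm)
  | square s => exact h.2.trans h'.2.symm

theorem Represents.nonempty (hn : 1 ≤ n) {α : Tiling n R} {v : GVertex} {A : Finset Square}
    (h : Represents α v A) : A.Nonempty := by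
  obtain ⟨s, hs, -⟩ := (h.isStrand hn).exists_mem v.lo le_rfl (v.lo_le_hi hn)
  exact ⟨s, hs⟩

theorem Represents.mem_tiles {α : Tiling n R} {c : ℤ} {i : ℕ} {A : Finset Square}
    (h : Represents α (.tile c i) A) : A ∈ α.tiles := h.1

theorem Represents.disjoint_of_ne (hn : 1 ≤ n) {α : Tiling n R} {v w : GVertex}
    {A B : Finset Square} (h : Represents α v A) (h' : Represents α w B) (hne : v ≠ w) :
    Disjoint A B := by
  cases v with
  | tile c i =>
    cases w with
    | tile d j =>
      refine α.pairwiseDisjoint A h.1 B h'.1 ?_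
      rintro rfl
      obtain ⟨h1, h2⟩ := (isTileAt_iff hn).1 h
      obtain ⟨h1', h2'⟩ := (isTileAt_iff hn).1 h'
      have : c = d := (Tiling.mem_levelTiles.1 h1).2.unique (Tiling.mem_levelTiles.1 h1').2
      subst this
      exact hne (by rw [← h2, ← h2'])
    | square s =>
      obtain ⟨hs, rfl⟩ := h'
      rw [Finset.disjoint_singleton_right]
      exact fun hs' => hs.1 (α.mem_region h.1 hs')
  | square r =>
    obtain ⟨hr, rfl⟩ := h
    rw [Finset.disjoint_singleton_left]
    cases w with
    | tile d j => exact fun hr' => hr.1 (α.mem_region h'.1 hr')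
    | square s =>
      obtain ⟨hs, rfl⟩ := h'
      rw [Finset.mem_singleton]
      rintro rfl
      exact hne rfl

theorem Represents.inj (hn : 1 ≤ n) {α : Tiling n R} {v w : GVertex} {A : Finset Square}
    (h : Represents α v A) (h' : Represents α w A) : v = w := by
  by_contra hne
  obtain ⟨s, hs⟩ := h.nonempty hn
  exact Finset.disjoint_left.1 (h.disjoint_of_ne hn h' hne) hs hs

theorem Tiling.exists_represents (hn : 1 ≤ n) (α : Tiling n R) {c : ℤ} {t : Finset Square}
    (ht : t ∈ α.levelTiles c) : ∃ i, Represents α (.tile c i) t :=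
  ⟨_, (isTileAt_iff hn).2 ⟨ht, rfl⟩⟩

/-- The tiles of `α` and the boundary squares. -/
def Tiling.family (α : Tiling n R) : Set (Finset Square) :=
  {A | ∃ v, Represents α v A}

theorem Tiling.mem_family_iff (hn : 1 ≤ n) {α : Tiling n R} {A : Finset Square} :
    A ∈ α.family ↔ A ∈ α.tiles ∨ ∃ s ∈ boundary R, A = {s} := by
  constructor
  · rintro ⟨v, hv⟩
    cases v with
    | tile c i => exact .inl hv.1
    | square s => exact .inr ⟨s, hv⟩
  · rintro (h | ⟨s, hs⟩)
    · obtain ⟨c, hc⟩ := α.exists_levelTiles hn h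
      obtain ⟨i, hi⟩ := α.exists_represents hn hc
      exact ⟨_, hi⟩
    · exact ⟨.square s, hs⟩

theorem finite_boundary (R : Finset Square) : (boundary R).Finite := by
  refine (R.finite_toSet.biUnion (t := fun s => {(s.1 + 1, s.2), (s.1 - 1, s.2), (s.1, s.2 + 1),
    (s.1, s.2 - 1)}) fun s _ => Set.toFinite _).subset ?_
  rintro ⟨x, y⟩ ⟨-, ⟨x', y'⟩, hs, hadj⟩
  rw [grid_adj_iff] at hadj
  simp only [level, pos] at hadj
  simp only [Set.mem_iUnion]
  refine ⟨(x', y'), hs, ?_⟩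
  simp only [Set.mem_insert_iff, Set.mem_singleton_iff, Prod.mk.injEq]
  omega

theorem Tiling.family_finite (hn : 1 ≤ n) (α : Tiling n R) : α.family.Finite := by
  refine (α.tiles.finite_toSet.union ((finite_boundary R).image fun s => {s})).subset ?_
  intro A hA
  rcases (mem_family_iff hn).1 hA with h | ⟨s, hs, rfl⟩
  · exact .inl h
  · exact .inr ⟨s, hs, rfl⟩

theorem Tiling.isStrandFamily (hn : 1 ≤ n) (α : Tiling n R) : IsStrandFamily α.family where
  isStrand := fun _ ⟨v, hv⟩ => ⟨_, _, v.lo_le_hi hn, hv.isStrand hn⟩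
  disjoint := fun A ⟨v, hv⟩ B ⟨w, hw⟩ hne => hv.disjoint_of_ne hn hw <| by
    rintro rfl
    exact hne (hv.unique hn hw)

theorem Represents.arc_iff (hn : 1 ≤ n) {α : Tiling n R} {v w : GVertex} {A B : Finset Square}
    (h : Represents α v A) (h' : Represents α w B) :
    (tilingGraph α).Arc v w ↔ v ≠ w ∧ LeftOf A B := by
  constructor
  · rintro ⟨hne, A', B', hA', hB', hl⟩
    rw [h.unique hn hA', h'.unique hn hB']
    exact ⟨hne, hl⟩
  · exact fun ⟨hne, hl⟩ => ⟨hne, A, B, h, h', hl⟩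

theorem familyRel_of_arc (hn : 1 ≤ n) {α : Tiling n R} {v w : GVertex}
    (h : (tilingGraph α).Arc v w) :
    ∃ A B, Represents α v A ∧ Represents α w B ∧ FamilyRel α.family A B := by
  obtain ⟨hne, A, B, hA, hB, hl⟩ := h
  refine ⟨A, B, hA, hB, ⟨v, hA⟩, ⟨w, hB⟩, ?_, hl⟩
  rintro rfl
  exact hne (hA.inj hn hB)

theorem tilingGraph_isAcyclic (hn : 1 ≤ n) (α : Tiling n R) : (tilingGraph α).IsAcyclic := by
  have key : ∀ v w, Relation.TransGen (tilingGraph α).Arc v w →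
      ∃ A B, Represents α v A ∧ Represents α w B ∧ Relation.TransGen (FamilyRel α.family) A B := by
    intro v w h
    induction h with
    | single h =>
      obtain ⟨A, B, hA, hB, hr⟩ := familyRel_of_arc hn h
      exact ⟨A, B, hA, hB, .single hr⟩
    | tail _ h ih =>
      obtain ⟨A, B, hA, hB, hr⟩ := ih
      obtain ⟨B', C, hB', hC, hr'⟩ := familyRel_of_arc hn h
      rw [hB.unique hn hB'] at hr
      exact ⟨A, C, hA, hC, hr.tail hr'⟩
  intro v h
  obtain ⟨A, B, hA, hB, hr⟩ := key v v h
  rw [hA.unique hn hB] at hr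
  exact (α.isStrandFamily hn).acyclic (α.family_finite hn) _ hr

theorem tilingGraph_arc_asymm (hn : 1 ≤ n) (α : Tiling n R) {v w : GVertex}
    (h : (tilingGraph α).Arc v w) : ¬ (tilingGraph α).Arc w v := fun h' =>
  tilingGraph_isAcyclic hn α v ((Relation.TransGen.single h).tail h')

/-- Two vertices are joined by an edge exactly when their ranges of levels overlap or are
contiguous. -/
theorem Represents.arc_or_arc_iff (hn : 1 ≤ n) {α : Tiling n R} {v w : GVertex}
    {A B : Finset Square} (h : Represents α v A) (h' : Represents α w B) :
    (tilingGraph α).Arc v w ∨ (tilingGraph α).Arc w v ↔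
      v ≠ w ∧ v.lo ≤ w.hi n + 1 ∧ w.lo ≤ v.hi n + 1 := by
  rw [h.arc_iff hn h', h'.arc_iff hn h]
  constructor
  · rintro (⟨hne, hl⟩ | ⟨hne, hl⟩)
    · exact ⟨hne, hl.bounds (h.isStrand hn) (h'.isStrand hn)⟩
    · exact ⟨hne.symm, (hl.bounds (h'.isStrand hn) (h.isStrand hn)).symm⟩
  · rintro ⟨hne, h1, h2⟩
    obtain ⟨s, hs, t, ht, hnear⟩ := (h.isStrand hn).exists_near (h'.isStrand hn)
      (v.lo_le_hi hn) (w.lo_le_hi hn) h1 h2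
    rcases leftOf_or (h.disjoint_of_ne hn h' hne) hs ht hnear with hl | hl
    · exact .inl ⟨hne, hl⟩
    · exact .inr ⟨hne.symm, hl⟩

end

/-! ### Potentials for the crossings of a ray -/

/-- Since closed paths in `R` do not wind around `s`, the signed crossings with the horizontal ray
from `s` are the differences of a function on `R`. -/
theorem exists_crossing_potential {R : Finset Square} (hR : IsRegion R) (hsc : IsSimplyConnected R)
    {s : Square} (hs : s ∉ R) :
    ∃ φ : Square → ℤ, ∀ a ∈ R, ∀ b ∈ R, grid.Adj a b → φ b - φ a = crossing s a b := by
  rcases R.eq_empty_or_nonempty with rfl | ⟨o, ho⟩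
  · exact ⟨0, by simp⟩
  let G := grid.induce (R : Set Square)
  let W : ∀ {x y : (R : Set Square)}, G.Walk x y → ℤ := fun p =>
    (p.darts.map fun d => crossing s d.fst.1 d.snd.1).sum
  have closed : ∀ x (p : G.Walk x x), W p = 0 := by
    intro x p
    have := hsc s hs _ (p.map (SimpleGraph.Embedding.induce (R : Set Square)).toHom) (by
      intro y hy
      rw [SimpleGraph.Walk.support_map, List.mem_map] at hy
      obtain ⟨z, -, rfl⟩ := hy
      exact z.2)
    rw [windingNumber, SimpleGraph.Walk.darts_map, List.map_map] at this
    exact this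
  have W_append : ∀ {x y z} (p : G.Walk x y) (q : G.Walk y z), W (p.append q) = W p + W q := by
    intro x y z p q
    simp only [W, SimpleGraph.Walk.darts_append, List.map_append, List.sum_append]
  have W_reverse : ∀ {x y} (p : G.Walk x y), W p.reverse = - W p := by
    intro x y p
    have h := closed x (p.append p.reverse)
    rw [W_append] at h
    omega
  let P : ∀ x, G.Walk ⟨o, ho⟩ x := fun x => (hR ⟨o, ho⟩ x).some
  refine ⟨fun a => if ha : a ∈ R then W (P ⟨a, ha⟩) else 0, fun a ha b hb hab => ?_⟩
  simp only [dif_pos ha, dif_pos hb]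
  have hab' : G.Adj ⟨a, ha⟩ ⟨b, hb⟩ := hab
  have h := closed _ (((P ⟨a, ha⟩).append (.cons hab' .nil)).append (P ⟨b, hb⟩).reverse)
  rw [W_append, W_append, W_reverse] at h
  have h' : W (SimpleGraph.Walk.cons hab' .nil) = crossing s a b := by simp [W]
  omega

/-- The staircase `l` is the lattice path separating the squares of level `l - 1` from those of
level `l`. An upward step of `R` changes `φ` by one if it crosses this staircase to the right of `s`,
and leaves `φ` unchanged otherwise. -/
def IsPotential (R : Finset Square) (s : Square) (l : ℤ) (φ : Square → ℤ) : Prop :=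
  ∀ a ∈ R, ∀ b ∈ R, grid.Adj a b → level b = level a + 1 →
    φ b - φ a = if level b = l ∧ pos s < pos b then 1 else 0

/-- The horizontal ray of the winding number can be replaced by the staircase ray: between the two
rays the potential changes by one. -/
theorem exists_isPotential {R : Finset Square} (hR : IsRegion R) (hsc : IsSimplyConnected R)
    {s : Square} (hs : s ∉ R) {l : ℤ} (hl : l = level s ∨ l = level s + 1) :
    ∃ φ, IsPotential R s l φ := by
  obtain ⟨φ, hφ⟩ := exists_crossing_potential hR hsc hs
  refine ⟨fun a => φ a + if s.1 < a.1 ∧ a.2 ≤ s.2 ∧ l ≤ level a then 1 else 0, ?_⟩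
  intro a ha b hb hab hlev
  have h := hφ a ha b hb hab
  have hadj := grid_adj_iff.1 hab
  have hna : ¬ (a.1 = s.1 ∧ a.2 = s.2) := fun e => hs (Prod.ext e.1 e.2 ▸ ha)
  have hnb : ¬ (b.1 = s.1 ∧ b.2 = s.2) := fun e => hs (Prod.ext e.1 e.2 ▸ hb)
  obtain ⟨a1, a2⟩ := a
  obtain ⟨b1, b2⟩ := b
  obtain ⟨s1, s2⟩ := s
  simp only [crossing, level, pos] at *
  have hcase : (b1 = a1 + 1 ∧ b2 = a2) ∨ (b1 = a1 ∧ b2 = a2 + 1) := by omega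
  rcases hcase with ⟨rfl, rfl⟩ | ⟨rfl, rfl⟩ <;> split_ifs at h ⊢ <;> omega

/-- Along a strand in `R` the potential increases by one exactly when the strand crosses the
staircase to the right of `s`. -/
theorem IsPotential.sub_eq {R : Finset Square} {s : Square} {l : ℤ} {φ : Square → ℤ}
    (hφ : IsPotential R s l φ) {lo hi : ℤ} {t : Finset Square} (ht : IsStrand lo hi t)
    (htR : t ⊆ R) {k m : ℤ} (hk : lo ≤ k) (hkm : k ≤ m) (hm : m ≤ hi) :
    φ (squareAt t m) - φ (squareAt t k) =
      if k < l ∧ l ≤ m ∧ pos s < pos (squareAt t l) then 1 else 0 := by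
  induction m, hkm using Int.leInduction with
  | base => rw [sub_self, if_neg (by omega)]
  | succ m hkm ih =>
    have ih := ih (by omega)
    have l1 := ht.level_squareAt (k := m) (by omega) (by omega)
    have l2 := ht.level_squareAt (k := m + 1) (by omega) (by omega)
    have m1 := ht.squareAt_mem (k := m) (by omega) (by omega)
    have m2 := ht.squareAt_mem (k := m + 1) (by omega) (by omega)
    have hst : level (squareAt t (m + 1)) = level (squareAt t m) + 1 := by rw [l1, l2]
    have h := hφ _ (htR m1) _ (htR m2) (grid_adj_iff.2 ⟨.inl hst, ht.step _ m1 _ m2 hst⟩) hst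
    rw [l2] at h
    by_cases hl : m + 1 = l
    · subst hl
      rw [if_neg (by omega)] at ih
      have e : (m + 1 = m + 1 ∧ pos s < pos (squareAt t (m + 1))) ↔
        (k < m + 1 ∧ m + 1 ≤ m + 1 ∧ pos s < pos (squareAt t (m + 1))) := by
          exact ⟨fun h => ⟨by omega, le_rfl, h.2⟩, fun h => ⟨rfl, h.2.2⟩⟩
      rw [if_congr e rfl rfl] at h
      omega
    · rw [if_neg (fun h => hl h.1)] at h
      have e : (k < l ∧ l ≤ m ∧ pos s < pos (squareAt t l)) ↔
          (k < l ∧ l ≤ m + 1 ∧ pos s < pos (squareAt t l)) := by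
        constructor <;> rintro ⟨h1, h2, h3⟩ <;> exact ⟨h1, by omega, h3⟩
      rw [if_congr e rfl rfl] at ih
      omega

/-! ### Invariants of the tilings of a simply connected region -/

section
variable {n : ℕ} {R : Finset Square}

/-- The sum of `φ` over the squares of `A` of colour `c - 1` minus its sum over the squares of
colour `c`. Being additive over tiles, it has the same total for all tilings of a region. -/
def colorSum (n : ℕ) (c : ℤ) (φ : Square → ℤ) (A : Finset Square) : ℤ :=
  ∑ s ∈ A, ((if (level s + 1 - c) % n = 0 then φ s else 0) -
    if (level s - c) % n = 0 then φ s else 0)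

/-- A tile has exactly one square of each colour, so a sum over a colour has a single term. -/
theorem sum_color_eq {A : Finset Square} {e k c : ℤ} (hA : IsStrand e (e + n - 1) A)
    (h1 : e ≤ k) (h2 : k ≤ e + n - 1) (hk : (k - c) % n = 0) (f : Square → ℤ) :
    ∑ s ∈ A, (if (level s - c) % n = 0 then f s else 0) = f (squareAt A k) := by
  have h := hA.sum_level (k := k) f
  rw [if_pos ⟨h1, h2⟩] at h
  rw [← h]
  refine Finset.sum_congr rfl fun s hs => ?_
  have hb := hA.bounds s hs
  refine if_congr ⟨fun hz => ?_, fun hz => hz ▸ hk⟩ rfl rfl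
  have hd : (n : ℤ) ∣ level s - k := by
    have := dvd_sub (Int.dvd_of_emod_eq_zero hz) (Int.dvd_of_emod_eq_zero hk)
    rwa [sub_sub_sub_cancel_right] at this
  have := Int.eq_zero_of_abs_lt_dvd hd (abs_lt.2 ⟨by omega, by omega⟩)
  omega

/-- A tile whose lowest colour is `c` contributes the crossing of its interior with the staircase
ray. -/
theorem colorSum_of_dvd (hn : 1 ≤ n) {s : Square} {l : ℤ} {φ : Square → ℤ}
    (hφ : IsPotential R s l φ) {t : Finset Square} {e c : ℤ} (ht : IsStrand e (e + n - 1) t)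
    (htR : t ⊆ R) (hc : (e - c) % n = 0) : colorSum n c φ t =
      if e < l ∧ l ≤ e + n - 1 ∧ pos s < pos (squareAt t l) then 1 else 0 := by
  rw [← hφ.sub_eq ht htR le_rfl (by omega) le_rfl, colorSum, Finset.sum_sub_distrib,
    sum_color_eq ht le_rfl (by omega) hc]
  congr 1
  have h := sum_color_eq (c := c - 1) (k := e + n - 1) ht (by omega) (by omega)
    (by rw [show e + (n : ℤ) - 1 - (c - 1) = e - c + n by ring, Int.add_emod_right, hc]) φ
  simpa only [sub_sub_eq_add_sub] using h

/-- Any other tile contributes minus its crossing with the staircase ray, provided that the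
staircase separates the colours `c - 1` and `c`. -/
theorem colorSum_of_not_dvd (hn : 1 ≤ n) {s : Square} {l : ℤ} {φ : Square → ℤ}
    (hφ : IsPotential R s l φ) {t : Finset Square} {e c : ℤ} (ht : IsStrand e (e + n - 1) t)
    (htR : t ⊆ R) (hc : (e - c) % n ≠ 0) : colorSum n c φ t =
      -if (l - c) % n = 0 ∧ e < l ∧ l ≤ e + n - 1 ∧ pos s < pos (squareAt t l) then 1 else 0 := by
  have hn' : (0 : ℤ) < n := by omega
  have m1 := Int.emod_nonneg (c - e) hn'.ne'
  have m2 := Int.emod_lt_of_pos (c - e) hn'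
  -- `k` is the level of the square of colour `c` of the tile; it is not the lowest level.
  obtain ⟨k, hk⟩ : ∃ k, k = e + (c - e) % n := ⟨_, rfl⟩
  have hkc : (k - c) % n = 0 := by
    have := Int.emod_add_mul_ediv (c - e) n
    rw [show k - c = n * (-((c - e) / n)) by rw [hk]; linarith, Int.mul_emod_right]
  have hke : e < k := by
    rcases m1.lt_or_eq with h | h
    · omega
    · exfalso
      apply hc
      have : (n : ℤ) ∣ c - e := Int.dvd_of_emod_eq_zero h.symm
      rw [← neg_sub c e]
      exact Int.emod_eq_zero_of_dvd (dvd_neg.2 this)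
  have hl : ((l - c) % n = 0 ∧ e < l ∧ l ≤ e + n - 1 ∧ pos s < pos (squareAt t l)) ↔
      (k - 1 < l ∧ l ≤ k ∧ pos s < pos (squareAt t l)) := by
    constructor
    · rintro ⟨h1, h2, h3, h4⟩
      have hd : (n : ℤ) ∣ l - k := by
        have := dvd_sub (Int.dvd_of_emod_eq_zero h1) (Int.dvd_of_emod_eq_zero hkc)
        rwa [sub_sub_sub_cancel_right] at this
      have := Int.eq_zero_of_abs_lt_dvd hd (abs_lt.2 ⟨by omega, by omega⟩)
      exact ⟨by omega, by omega, h4⟩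
    · rintro ⟨h1, h2, h3⟩
      obtain rfl : l = k := by omega
      exact ⟨hkc, hke, by omega, h3⟩
  rw [if_congr hl rfl rfl, ← hφ.sub_eq ht htR (by omega) (by omega) (by omega), neg_sub, colorSum,
    Finset.sum_sub_distrib, sum_color_eq ht hke.le (by omega) hkc]
  congr 1
  have h := sum_color_eq (c := c - 1) (k := k - 1) ht (by omega) (by omega)
    (by rw [show k - 1 - (c - 1) = k - c by ring, hkc]) φ
  simpa only [sub_sub_eq_add_sub] using h

open Classical in
/-- The number of tiles of level `c` to the right of `s`. -/
noncomputable def Tiling.countRight (α : Tiling n R) (c : ℤ) (s : Square) : ℕ :=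
  ((α.levelTiles c).filter fun t => LeftOf {s} t).card

open Classical in
theorem Tiling.countRight_eq_sum (α : Tiling n R) (c : ℤ) (s : Square) :
    (α.countRight c s : ℤ) =
      ∑ t ∈ α.tiles, if HasLevel t c ∧ LeftOf {s} t then 1 else 0 := by
  rw [countRight, levelTiles, Finset.filter_filter, Finset.card_filter]
  push_cast
  rfl

theorem Tiling.leftOf_singleton_iff (α : Tiling n R) {s : Square} (hs : s ∉ R) {a b : ℤ}
    {t : Finset Square} (ht : t ∈ α.tiles) (hst : IsStrand a b t) {k : ℤ} (h1 : a ≤ k) (h2 : k ≤ b)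
    (h3 : level s ≤ k + 1) (h4 : k ≤ level s + 1) :
    LeftOf {s} t ↔ pos s < pos (squareAt t k) := by
  have hd : Disjoint {s} t := by
    rw [Finset.disjoint_singleton_left]
    exact fun h => hs (α.mem_region ht h)
  have hm := hst.squareAt_mem h1 h2
  have hn : Near s (squareAt t k) := by
    unfold Near
    rw [hst.level_squareAt h1 h2]
    exact ⟨h3, h4⟩
  exact ⟨fun h => h.pos_lt (isStrand_singleton s) hst hd (Finset.mem_singleton_self s) hm hn,
    fun h => leftOf_of_pos_lt (Finset.mem_singleton_self s) hm hn h⟩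

/-- The number of tiles of level `c` to the right of a square outside `R` depends only on `R`. -/
theorem countRight_eq (hn : 1 ≤ n) (hR : IsRegion R) (hsc : IsSimplyConnected R)
    (α β : Tiling n R) {s : Square} (hs : s ∉ R) {c : ℤ} (h1 : c ≤ level s + 1)
    (h2 : level s ≤ c + n) : α.countRight c s = β.countRight c s := by
  classical
  -- It suffices to write the count as a sum over the squares of `R`.
  suffices h : ∃ f : Square → ℤ, ∀ γ : Tiling n R, ∀ t ∈ γ.tiles,
      (if HasLevel t c ∧ LeftOf {s} t then 1 else 0) = ∑ x ∈ t, f x by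
    obtain ⟨f, hf⟩ := h
    have e : ∀ γ : Tiling n R, (γ.countRight c s : ℤ) = ∑ x ∈ R, f x := fun γ => by
      rw [γ.countRight_eq_sum, γ.sum_eq]
      exact Finset.sum_congr rfl (hf γ)
    exact_mod_cast (e α).trans (e β).symm
  by_cases hmid : c ≤ level s ∧ level s ≤ c + n - 2
  · -- The tiles of level `c` are those of their type that cross the staircase above `s`.
    obtain ⟨φ, hφ⟩ := exists_isPotential hR hsc hs (.inr rfl)
    refine ⟨fun x => (if (level x + 1 - c) % n = 0 then φ x else 0) -
      if (level x - c) % n = 0 then φ x else 0, fun γ t ht => ?_⟩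
    obtain ⟨e, he⟩ := γ.exists_levelTiles hn ht
    have hst := γ.isStrand hn he
    have htR : t ⊆ R := fun x hx => γ.mem_region ht hx
    change _ = colorSum n c φ t
    have hlev := hst.hasLevel_iff (c := c) (by omega)
    by_cases hec : (e - c) % n = 0
    · rw [colorSum_of_dvd hn hφ hst htR hec]
      refine if_congr ⟨?_, ?_⟩ rfl rfl
      · rintro ⟨hL, h⟩
        obtain rfl := hlev.1 hL
        exact ⟨by omega, by omega, (γ.leftOf_singleton_iff hs ht hst (by omega) (by omega)
          (by omega) (by omega)).1 h⟩
      · rintro ⟨g1, g2, g3⟩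
        have := Int.eq_zero_of_abs_lt_dvd (Int.dvd_of_emod_eq_zero hec)
          (abs_lt.2 ⟨by omega, by omega⟩)
        exact ⟨hlev.2 (by omega), (γ.leftOf_singleton_iff hs ht hst (by omega) (by omega)
          (by omega) (by omega)).2 g3⟩
    · rw [colorSum_of_not_dvd hn hφ hst htR hec, if_neg, if_neg, neg_zero]
      · rintro ⟨g1, -⟩
        have := Int.eq_zero_of_abs_lt_dvd (Int.dvd_of_emod_eq_zero
          (show (level s + 1 - c) % n = 0 from g1)) (abs_lt.2 ⟨by omega, by omega⟩)
        omega
      · rintro ⟨hL, -⟩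
        obtain rfl := hlev.1 hL
        simp at hec
  · -- Otherwise `s` lies along the staircase `l` at which the tiles of level `c` begin or end, and
    -- the tiles beginning or ending there are counted by their squares, less those crossing it.
    by_cases hlow : level s = c - 1
    · obtain ⟨φ, hφ⟩ := exists_isPotential hR hsc hs (l := c) (.inr (by omega))
      refine ⟨fun x => (if level x = c then if pos s < pos x then 1 else 0 else 0) +
        ((if (level x + 1 - c) % n = 0 then φ x else 0) -
        if (level x - c) % n = 0 then φ x else 0), fun γ t ht => ?_⟩
      obtain ⟨e, he⟩ := γ.exists_levelTiles hn ht
      have hst := γ.isStrand hn he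
      have htR : t ⊆ R := fun x hx => γ.mem_region ht hx
      rw [Finset.sum_add_distrib]
      change _ = _ + colorSum n c φ t
      rw [hst.sum_level, hst.hasLevel_iff (by omega)]
      have hleft : e ≤ c → c ≤ e + n - 1 → (LeftOf {s} t ↔ pos s < pos (squareAt t c)) :=
        fun g1 g2 => γ.leftOf_singleton_iff hs ht hst g1 g2 (by omega) (by omega)
      by_cases hec : (e - c) % n = 0
      · rw [colorSum_of_dvd hn hφ hst htR hec]
        by_cases hin : e ≤ c ∧ c ≤ e + n - 1
        · have := Int.eq_zero_of_abs_lt_dvd (Int.dvd_of_emod_eq_zero hec)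
            (abs_lt.2 ⟨by omega, by omega⟩)
          obtain rfl : e = c := by omega
          rw [hleft le_rfl (by omega)]
          simp [hin]
        · rw [if_neg (by rintro ⟨rfl, -⟩; omega), if_neg hin, if_neg (by omega), add_zero]
      · have hne : e ≠ c := by rintro rfl; simp at hec
        rw [colorSum_of_not_dvd hn hφ hst htR hec]
        by_cases hin : e ≤ c ∧ c ≤ e + n - 1
        · have : e < c := by omega
          simp [hin, this, hne.symm]
        · rw [if_neg (by rintro ⟨rfl, -⟩; omega), if_neg hin, if_neg (by omega), neg_zero, add_zero]
    · obtain ⟨φ, hφ⟩ := exists_isPotential hR hsc hs (l := c + n) (by omega)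
      refine ⟨fun x => (if level x = c + n - 1 then if pos s < pos x then 1 else 0 else 0) +
        ((if (level x + 1 - c) % n = 0 then φ x else 0) -
        if (level x - c) % n = 0 then φ x else 0), fun γ t ht => ?_⟩
      obtain ⟨e, he⟩ := γ.exists_levelTiles hn ht
      have hst := γ.isStrand hn he
      have htR : t ⊆ R := fun x hx => γ.mem_region ht hx
      rw [Finset.sum_add_distrib]
      change _ = _ + colorSum n c φ t
      rw [hst.sum_level, hst.hasLevel_iff (by omega)]
      have hleft : e ≤ c + n - 1 → c + n - 1 ≤ e + n - 1 →
          (LeftOf {s} t ↔ pos s < pos (squareAt t (c + n - 1))) :=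
        fun g1 g2 => γ.leftOf_singleton_iff hs ht hst g1 g2 (by omega) (by omega)
      have hleft' : e ≤ c + n → c + n ≤ e + n - 1 →
          (LeftOf {s} t ↔ pos s < pos (squareAt t (c + n))) :=
        fun g1 g2 => γ.leftOf_singleton_iff hs ht hst g1 g2 (by omega) (by omega)
      by_cases hec : (e - c) % n = 0
      · rw [colorSum_of_dvd hn hφ hst htR hec]
        by_cases hin : e ≤ c + n - 1 ∧ c + n - 1 ≤ e + n - 1
        · have := Int.eq_zero_of_abs_lt_dvd (Int.dvd_of_emod_eq_zero hec)
            (abs_lt.2 ⟨by omega, by omega⟩)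
          obtain rfl : e = c := by omega
          rw [hleft (by omega) (by omega)]
          simp [hin]
        · rw [if_neg (by rintro ⟨rfl, -⟩; omega), if_neg hin, if_neg, add_zero]
          rintro ⟨g1, g2, -⟩
          have := Int.eq_zero_of_abs_lt_dvd (Int.dvd_of_emod_eq_zero
            (show (e - c - n) % n = 0 by rw [Int.sub_emod_right, hec]))
            (abs_lt.2 ⟨by omega, by omega⟩)
          omega
      · have hne : e ≠ c := by rintro rfl; simp at hec
        have hne' : e ≠ c + n := by rintro rfl; simp at hec
        rw [colorSum_of_not_dvd hn hφ hst htR hec]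
        by_cases hin : e ≤ c + n - 1 ∧ c + n - 1 ≤ e + n - 1
        · have hiff : pos s < pos (squareAt t (c + n - 1)) ↔ (c + n - c) % n = 0 ∧ e < c + n ∧
              c + n ≤ e + n - 1 ∧ pos s < pos (squareAt t (c + n)) := by
            rw [← hleft hin.1 hin.2, hleft' (by omega) (by omega)]
            exact ⟨fun h => ⟨by simp, by omega, by omega, h⟩, fun h => h.2.2.2⟩
          rw [if_neg (fun h => hne h.1.symm), if_pos hin, if_congr hiff rfl rfl, add_neg_cancel]
        · rw [if_neg (fun h => hne h.1.symm), if_neg hin, if_neg (by omega), neg_zero, add_zero]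

theorem card_levelTiles_eq (hn : 1 ≤ n) (hR : IsRegion R) (hsc : IsSimplyConnected R)
    (α β : Tiling n R) (c : ℤ) : (α.levelTiles c).card = (β.levelTiles c).card := by
  classical
  -- All tiles lie to the right of a square far to the left.
  obtain ⟨s, hl, hp⟩ : ∃ s, level s = c ∧ ∀ x ∈ R, pos s < pos x := by
    obtain ⟨m, hm⟩ : ∃ m, ∀ x ∈ R, m ≤ pos x := by
      obtain ⟨m, hm⟩ := (R.image pos).bddBelow
      exact ⟨m, fun x hx => hm (by exact_mod_cast Finset.mem_image_of_mem _ hx)⟩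
    obtain ⟨s, h1, h2⟩ := exists_square (k := c) (p := m - 1 - (m - 1 - c) % 2) (by omega)
    exact ⟨s, h1, fun x hx => by have := hm x hx; omega⟩
  have e : ∀ γ : Tiling n R, (γ.levelTiles c).card = γ.countRight c s := by
    intro γ
    rw [Tiling.countRight, Finset.filter_true_of_mem]
    intro t ht
    have hst := γ.isStrand hn ht
    have hm := hst.squareAt_mem le_rfl (by omega)
    exact leftOf_of_pos_lt (Finset.mem_singleton_self s) hm
      (near_of_level_eq (by rw [hl, hst.level_squareAt le_rfl (by omega)]))
      (hp _ (γ.mem_region (Tiling.mem_levelTiles.1 ht).1 hm))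
  rw [e, e]
  exact countRight_eq hn hR hsc α β (fun hs => lt_irrefl _ (hp s hs)) (by omega) (by omega)

end

section
variable {n : ℕ} {R : Finset Square}

/-! ### Forced edges -/

theorem Tiling.exists_isTileAt_iff (hn : 1 ≤ n) (α : Tiling n R) {c : ℤ} {i : ℕ} :
    (∃ t, IsTileAt α c i t) ↔ 1 ≤ i ∧ i ≤ (α.levelTiles c).card := by
  simp only [isTileAt_iff hn]
  constructor
  · rintro ⟨t, ht, rfl⟩
    exact Finset.mem_Icc.1 (rankIn_mem ht)
  · exact fun h => exists_rankIn_eq (α.basePos_injOn hn c) h.1 h.2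

theorem exists_represents_iff (hn : 1 ≤ n) (hR : IsRegion R) (hsc : IsSimplyConnected R)
    (α β : Tiling n R) (v : GVertex) :
    (∃ A, Represents α v A) ↔ ∃ A, Represents β v A := by
  cases v with
  | tile c i =>
    change (∃ A, IsTileAt α c i A) ↔ ∃ A, IsTileAt β c i A
    rw [α.exists_isTileAt_iff hn, β.exists_isTileAt_iff hn, card_levelTiles_eq hn hR hsc α β]
  | square s => exact Iff.rfl

/-- Tiles of the same level keep their order at all levels. -/
theorem Tiling.pos_le_of_basePos_le (hn : 1 ≤ n) (α : Tiling n R) {c : ℤ} {t t' : Finset Square}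
    (ht : t ∈ α.levelTiles c) (ht' : t' ∈ α.levelTiles c) (h : basePos c t ≤ basePos c t') {k : ℤ}
    (h1 : c ≤ k) (h2 : k ≤ c + n - 1) : pos (squareAt t k) ≤ pos (squareAt t' k) := by
  rcases eq_or_ne t t' with rfl | hne
  · exact le_rfl
  have hst := α.isStrand hn ht
  have hst' := α.isStrand hn ht'
  have hlt : basePos c t < basePos c t' :=
    h.lt_of_ne fun e => hne (α.basePos_injOn hn c ht ht' e)
  exact (((α.leftOf_iff_basePos hn ht ht' hne).2 hlt).pos_lt hst hst'
    (α.pairwiseDisjoint _ (mem_levelTiles.1 ht).1 _ (mem_levelTiles.1 ht').1 hne)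
    (hst.squareAt_mem h1 h2) (hst'.squareAt_mem h1 h2) (near_of_level_eq
      (by rw [hst.level_squareAt h1 h2, hst'.level_squareAt h1 h2]))).le

/-- Whether `t_{c,i}` lies to the right of a square outside `R` depends only on the number of tiles
of level `c` that do. -/
theorem Represents.leftOf_square_iff (hn : 1 ≤ n) {α : Tiling n R} {c : ℤ} {i : ℕ}
    {A : Finset Square} (h : Represents α (.tile c i) A) {s : Square} (hs : s ∉ R)
    (h1 : c ≤ level s + 1) (h2 : level s ≤ c + n) :
    LeftOf {s} A ↔ ¬ i + α.countRight c s ≤ (α.levelTiles c).card := by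
  classical
  obtain ⟨hA, rfl⟩ := (isTileAt_iff hn).1 h
  have down : ∀ x ∈ α.levelTiles c, ∀ y ∈ α.levelTiles c, basePos c x ≤ basePos c y →
      ¬ LeftOf {s} y → ¬ LeftOf {s} x := by
    intro x hx y hy hle hny hsx
    apply hny
    obtain ⟨k, hk⟩ : ∃ k, k = max c (min (level s) (c + n - 1)) := ⟨_, rfl⟩
    rw [α.leftOf_singleton_iff hs (Tiling.mem_levelTiles.1 hx).1 (α.isStrand hn hx) (k := k)
      (by omega) (by omega) (by omega) (by omega)] at hsx
    rw [α.leftOf_singleton_iff hs (Tiling.mem_levelTiles.1 hy).1 (α.isStrand hn hy) (k := k)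
      (by omega) (by omega) (by omega) (by omega)]
    exact hsx.trans_le (α.pos_le_of_basePos_le hn hx hy hle (by omega) (by omega))
  have key := rankIn_le_card_iff down hA
  have hcard := Finset.card_filter_add_card_filter_not (s := α.levelTiles c)
    (fun t => LeftOf {s} t)
  rw [← not_iff_not, not_not, key, ← hcard, Tiling.countRight]
  omega

theorem leftOf_square_iff_of_tilings (hn : 1 ≤ n) (hR : IsRegion R) (hsc : IsSimplyConnected R)
    {α β : Tiling n R} {c : ℤ} {i : ℕ} {A B : Finset Square} (hA : Represents α (.tile c i) A)
    (hB : Represents β (.tile c i) B) {s : Square} (hs : s ∉ R)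
    (h1 : c ≤ level s + 1) (h2 : level s ≤ c + n) : LeftOf {s} A ↔ LeftOf {s} B := by
  rw [hA.leftOf_square_iff hn hs h1 h2, hB.leftOf_square_iff hn hs h1 h2,
    card_levelTiles_eq hn hR hsc α β, countRight_eq hn hR hsc α β hs h1 h2]

/-- The difference of the numbers of squares of level `l` and of level `l - 1` to the left of the
position `p`, as a weight. -/
def levelDiff (l p : ℤ) (x : Square) : ℤ :=
  (if level x = l then if pos x < p then 1 else 0 else 0) -
    if level x = l - 1 then if pos x < p then 1 else 0 else 0

open Classical in
/-- A tile crossing the staircase contributes nothing. So, to the left of the lowest square of a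
tile `B` of level `c + n` the weight counts the tiles of level `c + n` minus those of level `c`. -/
theorem Tiling.sum_levelDiff (hn : 1 ≤ n) (α : Tiling n R) {c : ℤ} {B : Finset Square}
    (hB : B ∈ α.levelTiles (c + n)) :
    ∑ x ∈ R, levelDiff (c + n) (basePos (c + n) B) x =
      ((α.levelTiles (c + n)).filter fun t => basePos (c + n) t < basePos (c + n) B).card -
        ((α.levelTiles c).filter fun t => LeftOf t B).card := by
  have hBs := α.isStrand hn hB
  have hq := hBs.squareAt_mem le_rfl (by omega)
  have lq := hBs.level_squareAt le_rfl (by omega)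
  have hBt := (mem_levelTiles.1 hB).1
  simp only [levelTiles, Finset.filter_filter, Finset.card_filter]
  push_cast
  rw [← Finset.sum_sub_distrib, α.sum_eq]
  refine Finset.sum_congr rfl fun t ht => ?_
  obtain ⟨e, he⟩ := α.exists_levelTiles hn ht
  have hst := α.isStrand hn he
  have hlev : ∀ a, HasLevel t a ↔ a = e := fun a => hst.hasLevel_iff (by omega)
  simp only [levelDiff, Finset.sum_sub_distrib, hst.sum_level, hlev]
  by_cases hte : t = B
  · subst hte
    obtain rfl : c + n = e := (hlev _).1 (mem_levelTiles.1 hB).2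
    unfold basePos
    split_ifs <;> omega
  have hd := α.pairwiseDisjoint t ht B hBt hte
  unfold basePos
  by_cases hce : c = e
  · subst hce
    have hm := hst.squareAt_mem (k := c + n - 1) (by omega) le_rfl
    have hl := hst.level_squareAt (k := c + n - 1) (by omega) le_rfl
    have hnear : Near (squareAt t (c + n - 1)) (squareAt B (c + n)) := by
      unfold Near; omega
    by_cases hL : LeftOf t B
    · have := hL.pos_lt hst hBs hd hm hq hnear
      simp only [hL, and_true, if_true]
      split_ifs <;> omega
    · have := mt (leftOf_of_pos_lt hm hq hnear) hL
      simp only [hL, and_false, if_false]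
      split_ifs <;> omega
  by_cases h3 : e ≤ c + n - 1 ∧ c + n ≤ e + n - 1
  · have m1 := hst.squareAt_mem (k := c + n) (by omega) (by omega)
    have m2 := hst.squareAt_mem (k := c + n - 1) (by omega) (by omega)
    have l1 := hst.level_squareAt (k := c + n) (by omega) (by omega)
    have l2 := hst.level_squareAt (k := c + n - 1) (by omega) (by omega)
    have n1 : Near (squareAt t (c + n)) (squareAt B (c + n)) := by unfold Near; omega
    have n2 : Near (squareAt t (c + n - 1)) (squareAt B (c + n)) := by unfold Near; omega
    have h1 := hst.pos_lt hBs hd m1 m2 hq hq n1 n2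
    have h2 := hst.pos_lt hBs hd m2 m1 hq hq n2 n1
    split_ifs <;> omega
  · split_ifs <;> omega

theorem sum_levelDiff_eq {l p q : ℤ} (hpq : p ≤ q) (hp : (l - p) % 2 = 0) (hq : (l - q) % 2 = 0)
    (h : ∀ x, (level x = l ∨ level x = l - 1) → p ≤ pos x → pos x ≤ q → x ∈ R) :
    ∑ x ∈ R, levelDiff l q x = ∑ x ∈ R, levelDiff l p x := by
  rw [← sub_eq_zero, ← Finset.sum_sub_distrib]
  have e : ∀ x ∈ R, levelDiff l q x - levelDiff l p x =
      (if level x = l ∧ p ≤ pos x ∧ pos x < q then 1 else 0) -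
        if level x = l - 1 ∧ p ≤ pos x ∧ pos x < q then 1 else 0 := by
    intro x _
    unfold levelDiff
    split_ifs <;> omega
  rw [Finset.sum_congr rfl e, Finset.sum_sub_distrib, sub_eq_zero,
    Finset.sum_boole, Finset.sum_boole, Nat.cast_inj]
  -- In a full stretch of the staircase the squares of the two levels alternate.
  refine Finset.card_bij (fun x _ => (x.1, x.2 - 1)) ?_ ?_ ?_
  · intro x hx
    simp only [Finset.mem_filter] at hx ⊢
    obtain ⟨hx, hx'⟩ := hx
    have : level (x.1, x.2 - 1) = l - 1 ∧ p ≤ pos (x.1, x.2 - 1) ∧ pos (x.1, x.2 - 1) < q := by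
      simp only [level, pos] at *
      omega
    exact ⟨h _ (.inr this.1) this.2.1 this.2.2.le, this⟩
  · intro x _ y _ hxy
    simp only [Prod.mk.injEq] at hxy
    exact Prod.ext hxy.1 (by omega)
  · intro y hy
    simp only [Finset.mem_filter] at hy
    obtain ⟨hy, hy'⟩ := hy
    have : level (y.1, y.2 + 1) = l ∧ p ≤ pos (y.1, y.2 + 1) ∧ pos (y.1, y.2 + 1) < q := by
      simp only [level, pos] at *
      omega
    exact ⟨(y.1, y.2 + 1), by
      simp only [Finset.mem_filter]
      exact ⟨h _ (.inl this.1) this.2.1 this.2.2.le, this⟩, by simp⟩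

/-- Between the positions of `t_{c+n,j}` in two tilings the staircase lies entirely in `R`, because
a square outside `R` has the same number of tiles of level `c + n` on its right in both. -/
theorem sum_levelDiff_eq_of_basePos_le (hn : 1 ≤ n) (hR : IsRegion R) (hsc : IsSimplyConnected R)
    {α β : Tiling n R} {c : ℤ} {j : ℕ} {A B : Finset Square}
    (hA : Represents α (.tile (c + n) j) A) (hB : Represents β (.tile (c + n) j) B)
    (hle : basePos (c + n) A ≤ basePos (c + n) B) :
    ∑ x ∈ R, levelDiff (c + n) (basePos (c + n) B) x =
      ∑ x ∈ R, levelDiff (c + n) (basePos (c + n) A) x := by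
  have hAs := hA.isStrand hn
  have hBs := hB.isStrand hn
  simp only [GVertex.lo, GVertex.hi] at hAs hBs
  have mA := hAs.squareAt_mem le_rfl (by omega)
  have mB := hBs.squareAt_mem le_rfl (by omega)
  have lA := hAs.level_squareAt le_rfl (by omega)
  have lB := hBs.level_squareAt le_rfl (by omega)
  refine sum_levelDiff_eq hle ?_ ?_ ?_
  · simp only [basePos, level, pos] at *; omega
  · simp only [basePos, level, pos] at *; omega
  intro x hx h1 h2
  by_contra hxR
  have nA : Near x (squareAt A (c + n)) := by unfold Near; omega
  have nB : Near x (squareAt B (c + n)) := by unfold Near; omega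
  have hne : pos x ≠ basePos (c + n) B := fun e =>
    hxR (nB.eq_of_pos e ▸ β.mem_region hB.mem_tiles mB)
  have h := (leftOf_square_iff_of_tilings hn hR hsc hA hB hxR (by omega) (by omega)).2
    (leftOf_of_pos_lt (Finset.mem_singleton_self x) mB nB (h2.lt_of_ne hne))
  have hd : Disjoint {x} A := by
    rw [Finset.disjoint_singleton_left]
    exact fun hx => hxR (α.mem_region hA.mem_tiles hx)
  exact absurd (h.pos_lt (isStrand_singleton x) hAs hd (Finset.mem_singleton_self x) mA nA)
    (not_lt.2 h1)

open Classical in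
/-- The number of tiles of level `c` to the left of `t_{c+n,j}` depends only on `R`. -/
theorem card_leftOf_eq (hn : 1 ≤ n) (hR : IsRegion R) (hsc : IsSimplyConnected R)
    {α β : Tiling n R} {c : ℤ} {j : ℕ} {A B : Finset Square}
    (hA : Represents α (.tile (c + n) j) A) (hB : Represents β (.tile (c + n) j) B) :
    ((α.levelTiles c).filter fun t => LeftOf t A).card =
      ((β.levelTiles c).filter fun t => LeftOf t B).card := by
  obtain ⟨hA1, hA2⟩ := (isTileAt_iff hn).1 hA
  obtain ⟨hB1, hB2⟩ := (isTileAt_iff hn).1 hB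
  have eA := α.sum_levelDiff hn hA1
  have eB := β.sum_levelDiff hn hB1
  have e : ∑ x ∈ R, levelDiff (c + n) (basePos (c + n) A) x =
      ∑ x ∈ R, levelDiff (c + n) (basePos (c + n) B) x := by
    rcases le_total (basePos (c + n) A) (basePos (c + n) B) with h | h
    · exact (sum_levelDiff_eq_of_basePos_le hn hR hsc hA hB h).symm
    · exact sum_levelDiff_eq_of_basePos_le hn hR hsc hB hA h
  unfold rankIn at hA2 hB2
  omega

theorem arc_same_level (hn : 1 ≤ n) {α : Tiling n R} {c : ℤ} {i j : ℕ} {A B : Finset Square}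
    (hA : Represents α (.tile c i) A) (hB : Represents α (.tile c j) B) :
    (tilingGraph α).Arc (.tile c i) (.tile c j) ↔ i < j := by
  rw [hA.arc_iff hn hB]
  obtain ⟨hA1, hA2⟩ := (isTileAt_iff hn).1 hA
  obtain ⟨hB1, hB2⟩ := (isTileAt_iff hn).1 hB
  rcases eq_or_ne A B with rfl | hne
  · simp [← hA2, ← hB2]
  rw [α.leftOf_iff_basePos hn hA1 hB1 hne, ← rankIn_lt_iff hA1, hA2, hB2]
  constructor
  · exact fun h => h.2
  · exact fun h => ⟨fun e => by simp at e; omega, h⟩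

theorem arc_contiguous (hn : 1 ≤ n) (hR : IsRegion R) (hsc : IsSimplyConnected R)
    {α β : Tiling n R} {c : ℤ} {i j : ℕ} (h : (tilingGraph α).Arc (.tile c i) (.tile (c + n) j)) :
    (tilingGraph β).Arc (.tile c i) (.tile (c + n) j) := by
  classical
  obtain ⟨hne, A, B, hA, hB, hl⟩ := h
  obtain ⟨A', hA'⟩ := (exists_represents_iff hn hR hsc α β _).1 ⟨A, hA⟩
  obtain ⟨B', hB'⟩ := (exists_represents_iff hn hR hsc α β _).1 ⟨B, hB⟩
  refine ⟨hne, A', B', hA', hB', ?_⟩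
  have key : ∀ {γ : Tiling n R} {C D : Finset Square}, Represents γ (.tile c i) C →
      Represents γ (.tile (c + n) j) D →
      (LeftOf C D ↔ i ≤ ((γ.levelTiles c).filter fun t => LeftOf t D).card) := by
    intro γ C D hC hD
    obtain ⟨hC1, hC2⟩ := (isTileAt_iff hn).1 hC
    have hDs := hD.isStrand hn
    simp only [GVertex.lo, GVertex.hi] at hDs
    rw [← hC2]
    refine rankIn_le_card_iff (P := fun t => LeftOf t D) ?_ hC1
    intro x hx y hy hle hyD
    have hxs := γ.isStrand hn hx
    have hys := γ.isStrand hn hy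
    have hdy : Disjoint y D := by
      refine γ.pairwiseDisjoint y (Tiling.mem_levelTiles.1 hy).1 D hD.mem_tiles ?_
      rintro rfl
      have := (Tiling.mem_levelTiles.1 hy).2.unique
        (Tiling.mem_levelTiles.1 ((isTileAt_iff hn).1 hD).1).2
      omega
    have mx := hxs.squareAt_mem (k := c + n - 1) (by omega) le_rfl
    have my := hys.squareAt_mem (k := c + n - 1) (by omega) le_rfl
    have mD := hDs.squareAt_mem le_rfl (by omega)
    have lx := hxs.level_squareAt (k := c + n - 1) (by omega) le_rfl
    have ly := hys.level_squareAt (k := c + n - 1) (by omega) le_rfl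
    have lD := hDs.level_squareAt le_rfl (by omega)
    have h1 := hyD.pos_lt hys hDs hdy my mD (by unfold Near; omega)
    have h2 := γ.pos_le_of_basePos_le hn hx hy hle (k := c + n - 1) (by omega) le_rfl
    exact leftOf_of_pos_lt mx mD (by unfold Near; omega) (h2.trans_lt h1)
  rw [key hA' hB', ← card_leftOf_eq hn hR hsc hB hB', ← key hA hB]
  exact hl

/-- If the direction from `w` to `v` does not depend on the tiling, then neither does the opposite
one, since exactly one of them occurs. -/
theorem arc_of_forall_rev (hn : 1 ≤ n) (hR : IsRegion R) (hsc : IsSimplyConnected R)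
    {v w : GVertex} (h : ∀ α β : Tiling n R, (tilingGraph α).Arc w v → (tilingGraph β).Arc w v)
    {α β : Tiling n R} (hα : (tilingGraph α).Arc v w) : (tilingGraph β).Arc v w := by
  obtain ⟨hne, A, B, hA, hB, hl⟩ := hα
  obtain ⟨A', hA'⟩ := (exists_represents_iff hn hR hsc α β _).1 ⟨A, hA⟩
  obtain ⟨B', hB'⟩ := (exists_represents_iff hn hR hsc α β _).1 ⟨B, hB⟩
  have hα : (tilingGraph α).Arc v w := ⟨hne, A, B, hA, hB, hl⟩
  rcases (hA'.arc_or_arc_iff hn hB').2 ((hA.arc_or_arc_iff hn hB).1 (.inl hα)) with h' | h'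
  · exact h'
  · exact absurd (h β α h') (tilingGraph_arc_asymm hn α hα)

theorem arc_square_tile (hn : 1 ≤ n) (hR : IsRegion R) (hsc : IsSimplyConnected R)
    {α β : Tiling n R} {c : ℤ} {i : ℕ} {s : Square}
    (h : (tilingGraph α).Arc (.square s) (.tile c i)) :
    (tilingGraph β).Arc (.square s) (.tile c i) := by
  obtain ⟨hne, B, A, hB, hA, hl⟩ := h
  obtain ⟨A', hA'⟩ := (exists_represents_iff hn hR hsc α β _).1 ⟨A, hA⟩
  have hb := hl.bounds (hB.isStrand hn) (hA.isStrand hn)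
  obtain ⟨hs, rfl⟩ := hB
  simp only [GVertex.lo, GVertex.hi] at hb
  exact ⟨hne, {s}, A', ⟨hs, rfl⟩, hA',
    (leftOf_square_iff_of_tilings hn hR hsc hA hA' hs.1 (by omega) (by omega)).1 hl⟩

/-- Forced edges have the same direction in all tilings. -/
theorem arc_of_isForcedPair (hn : 1 ≤ n) (hR : IsRegion R) (hsc : IsSimplyConnected R)
    {α β : Tiling n R} {v w : GVertex} (hf : IsForcedPair n v w) (h : (tilingGraph α).Arc v w) :
    (tilingGraph β).Arc v w := by
  cases v with
  | square s =>
    cases w with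
    | square r =>
      obtain ⟨hne, A, B, hA, hB, hl⟩ := h
      exact ⟨hne, A, B, hA, hB, hl⟩
    | tile d j => exact arc_square_tile hn hR hsc h
  | tile c i =>
    cases w with
    | square r => exact arc_of_forall_rev hn hR hsc (fun _ _ => arc_square_tile hn hR hsc) h
    | tile d j =>
      obtain ⟨A, B, hA, hB, -⟩ := familyRel_of_arc hn h
      have hb := ((hA.arc_or_arc_iff hn hB).1 (.inl h)).2
      simp only [GVertex.lo, GVertex.hi] at hb
      have hcases : d = c ∨ d = c + n ∨ c = d + n := by
        obtain ⟨z, hz⟩ := Int.ModEq.dvd hf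
        have hn' : (0 : ℤ) < n := by omega
        have l1 : z < 2 := by by_contra; nlinarith
        have l2 : -2 < z := by by_contra; nlinarith
        obtain rfl | rfl | rfl : z = -1 ∨ z = 0 ∨ z = 1 := by omega
        all_goals omega
      rcases hcases with rfl | rfl | rfl
      · obtain ⟨A', hA'⟩ := (exists_represents_iff hn hR hsc α β _).1 ⟨A, hA⟩
        obtain ⟨B', hB'⟩ := (exists_represents_iff hn hR hsc α β _).1 ⟨B, hB⟩
        exact (arc_same_level hn hA' hB').2 ((arc_same_level hn hA hB).1 h)
      · exact arc_contiguous hn hR hsc h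
      · exact arc_of_forall_rev hn hR hsc (fun _ _ => arc_contiguous hn hR hsc) h

/-- The graph of every tiling has the same edges. -/
theorem arc_or_arc_of_tilings (hn : 1 ≤ n) (hR : IsRegion R) (hsc : IsSimplyConnected R)
    {α : Tiling n R} (β : Tiling n R) {v w : GVertex}
    (h : (tilingGraph α).Arc v w ∨ (tilingGraph α).Arc w v) :
    (tilingGraph β).Arc v w ∨ (tilingGraph β).Arc w v := by
  obtain ⟨A, B, hA, hB⟩ : ∃ A B, Represents α v A ∧ Represents α w B := by
    rcases h with ⟨-, A, B, hA, hB, -⟩ | ⟨-, A, B, hA, hB, -⟩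
    · exact ⟨A, B, hA, hB⟩
    · exact ⟨B, A, hB, hA⟩
  obtain ⟨A', hA'⟩ := (exists_represents_iff hn hR hsc α β _).1 ⟨A, hA⟩
  obtain ⟨B', hB'⟩ := (exists_represents_iff hn hR hsc α β _).1 ⟨B, hB⟩
  exact (hA'.arc_or_arc_iff hn hB').2 ((hA.arc_or_arc_iff hn hB).1 h)

theorem tilingGraph_mem_acyclicExtensions (hn : 1 ≤ n) (hR : IsRegion R)
    (hsc : IsSimplyConnected R) (α : Tiling n R) : tilingGraph α ∈ acyclicExtensions n R := by
  refine ⟨⟨?_, fun v w h => ⟨α, .inl h⟩, ?_⟩, ?_, tilingGraph_isAcyclic hn α⟩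
  · ext v
    cases v with
    | tile c i =>
      constructor
      · rintro ⟨A, hA⟩
        exact ⟨α, A, hA⟩
      · rintro ⟨β, A, hA⟩
        exact (exists_represents_iff hn hR hsc β α _).1 ⟨A, hA⟩
    | square s => exact ⟨fun ⟨A, hA⟩ => hA.1, fun h => ⟨{s}, h, rfl⟩⟩
  · rintro v w ⟨β, h⟩
    rcases arc_or_arc_of_tilings hn hR hsc α h with h | h
    · exact .inl ⟨h, tilingGraph_arc_asymm hn α h⟩
    · exact .inr ⟨h, tilingGraph_arc_asymm hn α h⟩
  · rintro v w ⟨hf, β, h⟩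
    exact arc_of_isForcedPair hn hR hsc hf h

/-! ### A tiling is determined by its graph -/

/-- Both tilings give the square `s` to the same vertex. -/
def SameVertex (α β : Tiling n R) (s : Square) : Prop :=
  ∀ v w A B, Represents α v A → Represents β w B → s ∈ A → s ∈ B → v = w

theorem Tiling.exists_represents_mem (hn : 1 ≤ n) (α : Tiling n R) {s : Square} (hs : s ∈ R) :
    ∃ c i A, Represents α (.tile c i) A ∧ s ∈ A := by
  obtain ⟨A, hA, hsA⟩ := α.exists_mem hs
  obtain ⟨c, hc⟩ := α.exists_levelTiles hn hA
  obtain ⟨i, hi⟩ := α.exists_represents hn hc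
  exact ⟨c, i, A, hi, hsA⟩

/-- At the leftmost square of its level that goes to different vertices `v` and `w` in `α` and
`β`, the tile `v` of `β` must lie further right. -/
theorem arc_of_not_sameVertex (hn : 1 ≤ n) {α β : Tiling n R} {s : Square} (hs : s ∈ R)
    (hmin : ∀ x ∈ R, level x = level s → pos x < pos s → SameVertex α β x)
    {v w : GVertex} {A A' B : Finset Square} (hA : Represents α v A) (hA' : Represents β v A')
    (hB : Represents β w B) (hsA : s ∈ A) (hsB : s ∈ B) (hne : v ≠ w) :
    (tilingGraph β).Arc w v := by
  obtain ⟨c, i, rfl⟩ : ∃ c i, v = .tile c i := by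
    cases v with
    | tile c i => exact ⟨c, i, rfl⟩
    | square b =>
      obtain ⟨hb, rfl⟩ := hA
      exact absurd (Finset.mem_singleton.1 hsA ▸ hs) hb.1
  have hb := (hA.isStrand hn).bounds s hsA
  obtain ⟨r, hr, er⟩ := (hA'.isStrand hn).exists_mem (level s) hb.1 hb.2
  have hrR := β.mem_region hA'.mem_tiles hr
  refine (hB.arc_iff hn hA').2 ⟨hne.symm, leftOf_of_pos_lt hsB hr (near_of_level_eq er.symm) ?_⟩
  rcases lt_trichotomy (pos r) (pos s) with h | h | h
  · obtain ⟨d, j, C, hC, hrC⟩ := α.exists_represents_mem hn hrR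
    obtain e := hmin r hrR er h _ _ _ _ hC hA' hrC hr
    rw [e] at hC
    obtain rfl := hA.unique hn hC
    have := (hA.isStrand hn).unique r hrC s hsA er
    subst this
    exact absurd h (lt_irrefl _)
  · obtain rfl := eq_of_level_pos er h
    exact absurd hr fun hr =>
      Finset.disjoint_left.1 (hA'.disjoint_of_ne hn hB hne) hr hsB
  · exact h

/-- At the leftmost square that violates the claim, each of the two vertices would have to lie
to the left of the other. -/
theorem sameVertex_of_tilingGraph_eq (hn : 1 ≤ n) {α β : Tiling n R}
    (h : tilingGraph α = tilingGraph β) {s : Square} (hs : s ∈ R) : SameVertex α β s := by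
  classical
  by_contra hbad
  obtain ⟨r, hr, hmin⟩ := (R.filter fun x => ¬ SameVertex α β x).exists_min_image pos
    ⟨s, Finset.mem_filter.2 ⟨hs, hbad⟩⟩
  obtain ⟨hrR, hr⟩ := Finset.mem_filter.1 hr
  have hlt : ∀ x ∈ R, pos x < pos r → SameVertex α β x := by
    intro x hx hlt
    by_contra hx'
    exact absurd (hmin x (Finset.mem_filter.2 ⟨hx, hx'⟩)) (not_le.2 hlt)
  apply hr
  intro v w A B hA hB hrA hrB
  by_contra hne
  have hv : v ∈ (tilingGraph β).verts := h ▸ ⟨A, hA⟩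
  have hw : w ∈ (tilingGraph α).verts := h ▸ ⟨B, hB⟩
  obtain ⟨A', hA'⟩ := hv
  obtain ⟨B', hB'⟩ := hw
  have h1 := arc_of_not_sameVertex hn hrR (fun x hx _ => hlt x hx) hA hA' hB hrA hrB hne
  have h2 := arc_of_not_sameVertex hn hrR
    (fun x hx _ hp v' w' _ _ g1 g2 g3 g4 => (hlt x hx hp w' v' _ _ g2 g1 g4 g3).symm)
    hB hB' hA hrB hrA (Ne.symm hne)
  rw [← h] at h1
  exact tilingGraph_arc_asymm hn α h1 h2

theorem tiles_subset_of_tilingGraph_eq (hn : 1 ≤ n) {α β : Tiling n R}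
    (h : tilingGraph α = tilingGraph β) : α.tiles ⊆ β.tiles := by
  intro t ht
  obtain ⟨c, hc⟩ := α.exists_levelTiles hn ht
  obtain ⟨i, hi⟩ := α.exists_represents hn hc
  have hv : GVertex.tile c i ∈ (tilingGraph β).verts := h ▸ ⟨t, hi⟩
  obtain ⟨t', ht'⟩ := hv
  have sub : t ⊆ t' := by
    intro s hs
    obtain ⟨d, j, B, hB, hsB⟩ := β.exists_represents_mem hn (α.mem_region ht hs)
    have e := sameVertex_of_tilingGraph_eq hn h (α.mem_region ht hs) _ _ _ _ hi hB hs hsB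
    rw [← e] at hB
    rwa [ht'.unique hn hB]
  have : t = t' := by
    refine sub.antisymm fun s hs => ?_
    have hst' := ht'.isStrand hn
    have hb := hst'.bounds s hs
    obtain ⟨r, hr, er⟩ := (hi.isStrand hn).exists_mem (level s) hb.1 hb.2
    rwa [← hst'.unique r (sub hr) s hs er]
  exact this ▸ ht'.mem_tiles

theorem tilingGraph_injective (hn : 1 ≤ n) :
    Function.Injective fun α : Tiling n R => tilingGraph α := fun _ _ h =>
  Tiling.ext ((tiles_subset_of_tilingGraph_eq hn h).antisymm
    (tiles_subset_of_tilingGraph_eq hn h.symm))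

end

/-! ### Exchanging parts of two tiles -/

theorem IsStrand.filter_lt {a b m : ℤ} {A : Finset Square} (h : IsStrand a b A) (hm : m ≤ b + 1) :
    IsStrand a (m - 1) (A.filter fun s => level s < m) where
  bounds s hs := by
    have := h.bounds s (Finset.mem_filter.1 hs).1
    have := (Finset.mem_filter.1 hs).2
    omega
  exists_mem k h1 h2 := by
    obtain ⟨s, hs, e⟩ := h.exists_mem k h1 (by omega)
    exact ⟨s, Finset.mem_filter.2 ⟨hs, by omega⟩, e⟩
  unique s hs t ht := h.unique s (Finset.mem_filter.1 hs).1 t (Finset.mem_filter.1 ht).1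
  step s hs t ht := h.step s (Finset.mem_filter.1 hs).1 t (Finset.mem_filter.1 ht).1

theorem IsStrand.filter_ge {a b m : ℤ} {A : Finset Square} (h : IsStrand a b A) (hm : a ≤ m) :
    IsStrand m b (A.filter fun s => m ≤ level s) where
  bounds s hs := by
    have := h.bounds s (Finset.mem_filter.1 hs).1
    have := (Finset.mem_filter.1 hs).2
    omega
  exists_mem k h1 h2 := by
    obtain ⟨s, hs, e⟩ := h.exists_mem k (by omega) h2
    exact ⟨s, Finset.mem_filter.2 ⟨hs, by omega⟩, e⟩
  unique s hs t ht := h.unique s (Finset.mem_filter.1 hs).1 t (Finset.mem_filter.1 ht).1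
  step s hs t ht := h.step s (Finset.mem_filter.1 hs).1 t (Finset.mem_filter.1 ht).1

/-- Stacking two strands whose extreme squares are adjacent. -/
theorem IsStrand.union {a m b : ℤ} {A B : Finset Square} (hA : IsStrand a (m - 1) A)
    (hB : IsStrand m b B) (ham : a ≤ m) (hmb : m ≤ b + 1)
    (hstep : ∀ s ∈ A, ∀ t ∈ B, level s = m - 1 → level t = m →
      pos t = pos s + 1 ∨ pos s = pos t + 1) : IsStrand a b (A ∪ B) where
  bounds s hs := by
    rcases Finset.mem_union.1 hs with hs | hs
    · have := hA.bounds s hs; omega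
    · have := hB.bounds s hs; omega
  exists_mem k h1 h2 := by
    rcases lt_or_ge k m with h | h
    · obtain ⟨s, hs, e⟩ := hA.exists_mem k h1 (by omega)
      exact ⟨s, Finset.mem_union_left _ hs, e⟩
    · obtain ⟨s, hs, e⟩ := hB.exists_mem k h h2
      exact ⟨s, Finset.mem_union_right _ hs, e⟩
  unique s hs t ht e := by
    rcases Finset.mem_union.1 hs with hs | hs <;> rcases Finset.mem_union.1 ht with ht | ht
    · exact hA.unique s hs t ht e
    · have := hA.bounds s hs; have := hB.bounds t ht; omega
    · have := hB.bounds s hs; have := hA.bounds t ht; omega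
    · exact hB.unique s hs t ht e
  step s hs t ht e := by
    rcases Finset.mem_union.1 hs with hs | hs <;> rcases Finset.mem_union.1 ht with ht | ht
    · exact hA.step s hs t ht e
    · have := hA.bounds s hs
      have := hB.bounds t ht
      exact hstep s hs t ht (by omega) (by omega)
    · have := hB.bounds s hs; have := hA.bounds t ht; omega
    · exact hB.step s hs t ht e

/-- The squares of `A` below level `d` and those of `B` below level `e`. -/
def swapLow (d e : ℤ) (A B : Finset Square) : Finset Square :=
  (A.filter fun s => level s < d) ∪ B.filter fun s => level s < e

/-- The squares of `A` from level `d` on and those of `B` from level `e` on. -/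
def swapHigh (d e : ℤ) (A B : Finset Square) : Finset Square :=
  (A.filter fun s => d ≤ level s) ∪ B.filter fun s => e ≤ level s

theorem swapLow_union_swapHigh (d e : ℤ) (A B : Finset Square) :
    swapLow d e A B ∪ swapHigh d e A B = A ∪ B := by
  ext s
  simp only [swapLow, swapHigh, Finset.mem_union, Finset.mem_filter]
  have h1 := lt_or_ge (level s) d
  have h2 := lt_or_ge (level s) e
  tauto

theorem disjoint_swap {d e : ℤ} {A B : Finset Square} (h : Disjoint A B) :
    Disjoint (swapLow d e A B) (swapHigh d e A B) := by
  rw [Finset.disjoint_left] at h ⊢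
  intro s hs hs'
  simp only [swapLow, swapHigh, Finset.mem_union, Finset.mem_filter] at hs hs'
  have h3 := @h s
  rcases hs with ⟨h1, h2⟩ | ⟨h1, h2⟩ <;> rcases hs' with ⟨h1', h2'⟩ | ⟨h1', h2'⟩
  · omega
  · exact h3 h1 h1'
  · exact h3 h1' h1
  · omega

section
variable {n : ℕ} {R : Finset Square}

theorem IsStrand.swapLow {c d : ℤ} {A B : Finset Square} (hA : IsStrand c (c + n - 1) A)
    (hB : IsStrand d (d + n - 1) B) (hcd : c < d) (hdc : d < c + n)
    (hstep : ∀ s ∈ A, ∀ t ∈ B, level s = d - 1 → level t = d →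
      pos t = pos s + 1 ∨ pos s = pos t + 1) :
    IsStrand c (c + n - 1) (swapLow d (c + n) A B) := by
  refine (hA.filter_lt (by omega)).union (hB.filter_lt (by omega)) hcd.le (by omega) ?_
  intro s hs t ht
  exact hstep s (Finset.mem_filter.1 hs).1 t (Finset.mem_filter.1 ht).1

theorem IsStrand.swapHigh {c d : ℤ} {A B : Finset Square} (hA : IsStrand c (c + n - 1) A)
    (hB : IsStrand d (d + n - 1) B) (hcd : c < d) (hdc : d < c + n)
    (hstep : ∀ s ∈ A, ∀ t ∈ B, level s = c + n - 1 → level t = c + n →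
      pos t = pos s + 1 ∨ pos s = pos t + 1) :
    IsStrand d (d + n - 1) (swapHigh d (c + n) A B) := by
  refine (hA.filter_ge hcd.le).union (hB.filter_ge (by omega)) (by omega) (by omega) ?_
  intro s hs t ht
  exact hstep s (Finset.mem_filter.1 hs).1 t (Finset.mem_filter.1 ht).1

/-- `A` lies to the left of `B` and no tile or boundary square lies between them. -/
structure Tiling.Consecutive (α : Tiling n R) (A B : Finset Square) : Prop where
  left : A ∈ α.tiles
  right : B ∈ α.tiles
  ne : A ≠ B
  leftOf : LeftOf A B
  not_between : ∀ C ∈ α.family, C ≠ A → C ≠ B → ¬ (LeftOf A C ∧ LeftOf C B)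

/-- On a staircase met by two consecutive tiles, they occupy neighbouring positions: a square
between them would belong to another tile or to the boundary. -/
theorem Tiling.Consecutive.pos_eq (hn : 1 ≤ n) {α : Tiling n R} {A B : Finset Square}
    (h : α.Consecutive A B) {l : ℤ} {p q : Square} (hp : p ∈ A) (hq : q ∈ B)
    (hpl : level p = l - 1 ∨ level p = l) (hql : level q = l - 1 ∨ level q = l)
    (hpmax : ∀ x ∈ A, (level x = l - 1 ∨ level x = l) → pos x ≤ pos p)
    (hqmin : ∀ x ∈ B, (level x = l - 1 ∨ level x = l) → pos q ≤ pos x) (hlt : pos p < pos q) :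
    pos q = pos p + 1 := by
  by_contra hne
  obtain ⟨r, hr1, hr2⟩ := exists_square (k := 2 * l - 1 - level p) (p := pos p + 1)
    (by simp only [level, pos]; omega)
  have hrl : level r = l - 1 ∨ level r = l := by omega
  have hrA : r ∉ A := fun hr => by have := hpmax r hr hrl; omega
  have hrB : r ∉ B := fun hr => by have := hqmin r hr hrl; omega
  have npr : Near p r := by unfold Near; omega
  have nrq : Near r q := by unfold Near; omega
  have key : ∀ C ∈ α.family, r ∈ C → False := fun C hC hrC =>
    h.not_between C hC (by rintro rfl; exact hrA hrC) (by rintro rfl; exact hrB hrC)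
      ⟨leftOf_of_pos_lt hp hrC npr (by omega), leftOf_of_pos_lt hrC hq nrq (by omega)⟩
  by_cases hrR : r ∈ R
  · obtain ⟨C, hC, hrC⟩ := α.exists_mem hrR
    exact key C ((Tiling.mem_family_iff hn).2 (.inl hC)) hrC
  · refine key {r} ((Tiling.mem_family_iff hn).2 (.inr ⟨r, ⟨hrR, p, α.mem_region h.left hp, ?_⟩,
      rfl⟩)) (Finset.mem_singleton_self r)
    exact grid_adj_iff.2 ⟨by omega, by omega⟩

/-- If `X` crosses a staircase and `Y` has the single square `y` on it, then the square of `X` on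
the other side of the staircase is adjacent to `y`. -/
theorem Tiling.Consecutive.adjacent (hn : 1 ≤ n) {α : Tiling n R} {X Y : Finset Square}
    (h : α.Consecutive X Y ∨ α.Consecutive Y X) {a b a' b' l : ℤ} (hX : IsStrand a b X)
    (hY : IsStrand a' b' Y) (hal : a < l) (hlb : l ≤ b) {x y : Square} (hx : x ∈ X) (hy : y ∈ Y)
    (hxl : level x = l - 1 ∨ level x = l) (hyl : level y = 2 * l - 1 - level x)
    (hone : ∀ z ∈ Y, (level z = l - 1 ∨ level z = l) → z = y) :
    pos y = pos x + 1 ∨ pos x = pos y + 1 := by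
  -- `w` is the other square of `X` on the staircase.
  obtain ⟨w, hw, hwl⟩ := hX.exists_mem (level y) (by omega) (by omega)
  have hxw : pos w = pos x + 1 ∨ pos x = pos w + 1 := by
    rcases hxl with e | e
    · exact hX.step x hx w hw (by omega)
    · exact (hX.step w hw x hx (by omega)).symm
  have htwo : ∀ z ∈ X, (level z = l - 1 ∨ level z = l) → z = x ∨ z = w := by
    intro z hz hzl
    by_cases e : level z = level x
    · exact .inl (hX.unique z hz x hx e)
    · exact .inr (hX.unique z hz w hw (by omega))
  have par : (pos w - pos y) % 2 = 0 := by
    simp only [level, pos] at *; omega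
  have nxy : Near x y := by unfold Near; omega
  have nwy : Near w y := near_of_level_eq hwl
  rcases h with h | h
  · have hd := α.pairwiseDisjoint _ h.left _ h.right h.ne
    have l1 := h.leftOf.pos_lt hX hY hd hx hy nxy
    have l2 := h.leftOf.pos_lt hX hY hd hw hy nwy
    have ymin : ∀ z ∈ Y, (level z = l - 1 ∨ level z = l) → pos y ≤ pos z :=
      fun z hz hzl => (hone z hz hzl) ▸ le_rfl
    rcases hxw with e | e
    · have := h.pos_eq hn hw hy (by omega) (by omega) (fun z hz hzl => by
        rcases htwo z hz hzl with rfl | rfl <;> omega) ymin l2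
      omega
    · exact .inl (h.pos_eq hn hx hy (by omega) (by omega) (fun z hz hzl => by
        rcases htwo z hz hzl with rfl | rfl <;> omega) ymin l1)
  · have hd := α.pairwiseDisjoint _ h.left _ h.right h.ne
    have l1 := h.leftOf.pos_lt hY hX hd hy hx nxy.symm
    have l2 := h.leftOf.pos_lt hY hX hd hy hw nwy.symm
    have ymax : ∀ z ∈ Y, (level z = l - 1 ∨ level z = l) → pos z ≤ pos y :=
      fun z hz hzl => (hone z hz hzl) ▸ le_rfl
    rcases hxw with e | e
    · exact .inr (h.pos_eq hn hy hx (by omega) (by omega) ymax (fun z hz hzl => by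
        rcases htwo z hz hzl with rfl | rfl <;> omega) l1)
    · have := h.pos_eq hn hy hw (by omega) (by omega) ymax (fun z hz hzl => by
        rcases htwo z hz hzl with rfl | rfl <;> omega) l2
      omega

/-- The tilings `α` and `β` differ by replacing the tiles `A`, `B`, of levels `c` and `d`, by tiles
`A'`, `B'` of the same levels. -/
structure IsExchange (α β : Tiling n R) (c d : ℤ) (A B A' B' : Finset Square) : Prop where
  left : A ∈ α.levelTiles c
  right : B ∈ α.levelTiles d
  left' : A' ∈ β.levelTiles c
  right' : B' ∈ β.levelTiles d
  levels_ne : c ≠ d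
  union_eq : A' ∪ B' = A ∪ B
  mem_iff : ∀ t, t ≠ A' → t ≠ B' → (t ∈ β.tiles ↔ t ∈ α.tiles ∧ t ≠ A ∧ t ≠ B)

theorem IsExchange.symm {α β : Tiling n R} {c d : ℤ} {A B A' B' : Finset Square}
    (h : IsExchange α β c d A B A' B') : IsExchange α β d c B A B' A' where
  left := h.right
  right := h.left
  left' := h.right'
  right' := h.left'
  levels_ne := h.levels_ne.symm
  union_eq := by rw [Finset.union_comm, h.union_eq, Finset.union_comm]
  mem_iff t h1 h2 := by rw [h.mem_iff t h2 h1, and_comm (a := t ≠ A)]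

theorem IsExchange.ne {α β : Tiling n R} {c d : ℤ} {A B A' B' : Finset Square}
    (h : IsExchange α β c d A B A' B') : A ≠ B := by
  rintro rfl
  exact h.levels_ne ((Tiling.mem_levelTiles.1 h.left).2.unique (Tiling.mem_levelTiles.1 h.right).2)

theorem IsStrand.nonempty {a b : ℤ} {A : Finset Square} (h : IsStrand a b A) (hab : a ≤ b) :
    A.Nonempty := by
  obtain ⟨s, hs, -⟩ := h.exists_mem a le_rfl hab
  exact ⟨s, hs⟩

/-- Two consecutive tiles of levels `c < d` that overlap can be replaced: on each of the
staircases `d` and `c + n` one of them has a single square, which is adjacent to a square of the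
other on the far side, so the tiles can trade their squares at the common levels. -/
theorem exists_swap (hn : 1 ≤ n) {α : Tiling n R} {A B : Finset Square} {c d : ℤ}
    (hA : A ∈ α.levelTiles c) (hB : B ∈ α.levelTiles d) (hcd : c < d) (hdc : d < c + n)
    (h : α.Consecutive A B ∨ α.Consecutive B A) :
    ∃ β : Tiling n R, LocalMove α β ∧ ∃ A' B', IsExchange α β c d A B A' B' ∧
      (LeftOf A B → LeftOf B' A') ∧ (LeftOf B A → LeftOf A' B') := by
  have hAs := α.isStrand hn hA
  have hBs := α.isStrand hn hB
  have hAt := (Tiling.mem_levelTiles.1 hA).1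
  have hBt := (Tiling.mem_levelTiles.1 hB).1
  have hne : A ≠ B := h.elim (fun h => h.ne) fun h => h.ne.symm
  have hd := α.pairwiseDisjoint A hAt B hBt hne
  have step1 : ∀ s ∈ A, ∀ t ∈ B, level s = d - 1 → level t = d →
      pos t = pos s + 1 ∨ pos s = pos t + 1 := fun s hs t ht e1 e2 =>
    Tiling.Consecutive.adjacent hn h hAs hBs (l := d) hcd (by omega) hs ht (.inl e1) (by omega)
      fun z hz hzl => hBs.unique z hz t ht (by have := hBs.bounds z hz; omega)
  have step2 : ∀ s ∈ A, ∀ t ∈ B, level s = c + n - 1 → level t = c + n →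
      pos t = pos s + 1 ∨ pos s = pos t + 1 := fun s hs t ht e1 e2 =>
    (Tiling.Consecutive.adjacent hn h.symm hBs hAs (l := c + n) hdc (by omega) ht hs (.inr e2)
      (by omega) fun z hz hzl => hAs.unique z hz s hs (by have := hAs.bounds z hz; omega)).symm
  have hA's := hAs.swapLow hBs hcd hdc step1
  have hB's := hAs.swapHigh hBs hcd hdc step2
  have hun := swapLow_union_swapHigh d (c + n) A B
  have hd' := disjoint_swap (d := d) (e := c + n) hd
  have hlow : ∀ s, s ∈ swapLow d (c + n) A B ↔
      (s ∈ A ∧ level s < d) ∨ (s ∈ B ∧ level s < c + n) := fun s => by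
    simp only [swapLow, Finset.mem_union, Finset.mem_filter]
  have hhigh : ∀ s, s ∈ swapHigh d (c + n) A B ↔
      (s ∈ A ∧ d ≤ level s) ∨ (s ∈ B ∧ c + n ≤ level s) := fun s => by
    simp only [swapHigh, Finset.mem_union, Finset.mem_filter]
  obtain ⟨a, ha, la⟩ := hAs.exists_mem d (by omega) (by omega)
  obtain ⟨b, hb, lb⟩ := hBs.exists_mem d (by omega) (by omega)
  obtain ⟨o, ho, lo⟩ := hAs.exists_mem c (by omega) (by omega)
  have hbl : b ∈ swapLow d (c + n) A B := (hlow b).2 (.inr ⟨hb, by omega⟩)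
  have hah : a ∈ swapHigh d (c + n) A B := (hhigh a).2 (.inl ⟨ha, by omega⟩)
  have hol : o ∈ swapLow d (c + n) A B := (hlow o).2 (.inl ⟨ho, by omega⟩)
  generalize swapLow d (c + n) A B = A' at *
  generalize swapHigh d (c + n) A B = B' at *
  have hAA' : A' ≠ A := by
    rintro rfl
    exact Finset.disjoint_left.1 hd hbl hb
  have hAB' : A' ≠ B := by
    rintro rfl
    exact Finset.disjoint_left.1 hd ho hol
  have hne' : A' ≠ B' := by
    rintro rfl
    exact Finset.disjoint_left.1 hd' hol hol
  have other : ∀ t ∈ α.tiles, t ≠ A → t ≠ B → Disjoint A' t ∧ Disjoint B' t := by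
    intro t ht htA htB
    rw [← Finset.disjoint_union_left, hun, Finset.disjoint_union_left]
    exact ⟨α.pairwiseDisjoint A hAt t ht htA.symm, α.pairwiseDisjoint B hBt t ht htB.symm⟩
  let T : Finset (Finset Square) := α.tiles \ {A, B}
  have hT : ∀ t, t ∈ T ↔ t ∈ α.tiles ∧ t ≠ A ∧ t ≠ B := fun t => by
    simp [T]
  have hA'T : A' ∉ T := fun hmem => by
    obtain ⟨h1, h2, h3⟩ := (hT _).1 hmem
    exact Finset.disjoint_left.1 (other _ h1 h2 h3).1 hol hol
  have hB'T : B' ∉ T := fun hmem => by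
    obtain ⟨h1, h2, h3⟩ := (hT _).1 hmem
    exact Finset.disjoint_left.1 (other _ h1 h2 h3).2 hah hah
  let β : Tiling n R :=
    { tiles := insert A' (insert B' T)
      isRibbonTile := by
        intro t ht
        rcases Finset.mem_insert.1 ht with rfl | ht
        · exact hA's.isRibbonTile hn
        rcases Finset.mem_insert.1 ht with rfl | ht
        · exact hB's.isRibbonTile hn
        · exact α.isRibbonTile t ((hT t).1 ht).1
      pairwiseDisjoint := by
        intro t ht t' ht' htt'
        have hcase : ∀ u ∈ insert A' (insert B' T), u = A' ∨ u = B' ∨ u ∈ T := fun u hu => by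
          simpa only [Finset.mem_insert] using hu
        have hTd : ∀ u ∈ T, Disjoint A' u ∧ Disjoint B' u := fun u hu =>
          other u ((hT u).1 hu).1 ((hT u).1 hu).2.1 ((hT u).1 hu).2.2
        rcases hcase t ht with e | e | e <;> rcases hcase t' ht' with e' | e' | e'
        · exact absurd (e.trans e'.symm) htt'
        · rw [e, e']; exact hd'
        · rw [e]; exact (hTd t' e').1
        · rw [e, e']; exact hd'.symm
        · exact absurd (e.trans e'.symm) htt'
        · rw [e]; exact (hTd t' e').2
        · rw [e']; exact (hTd t e).1.symm
        · rw [e']; exact (hTd t e).2.symm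
        · exact α.pairwiseDisjoint t ((hT t).1 e).1 t' ((hT t').1 e').1 htt'
      covers := by
        rw [Finset.biUnion_insert, Finset.biUnion_insert, ← Finset.union_assoc, id, id, hun,
          ← α.covers]
        have : α.tiles = insert A (insert B T) := by
          ext t
          simp only [Finset.mem_insert, hT]
          constructor
          · tauto
          · rintro (rfl | rfl | h)
            exacts [hAt, hBt, h.1]
        rw [this, Finset.biUnion_insert, Finset.biUnion_insert, ← Finset.union_assoc, id, id] }
  have hβ : ∀ t, t ∈ β.tiles ↔ t = A' ∨ t = B' ∨ t ∈ T := fun t => by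
    simp [β]
  have hA'lev : HasLevel A' c := (hA's.hasLevel_iff (by omega)).2 rfl
  have hB'lev : HasLevel B' d := (hB's.hasLevel_iff (by omega)).2 rfl
  refine ⟨β, ⟨{A, B}, {A', B'}, Finset.card_pair hne, Finset.card_pair hne', ?_, ?_, ?_, ?_⟩,
    A', B', ⟨hA, hB, Tiling.mem_levelTiles.2 ⟨(hβ _).2 (.inl rfl), hA'lev⟩,
    Tiling.mem_levelTiles.2 ⟨(hβ _).2 (.inr (.inl rfl)), hB'lev⟩, hcd.ne, hun, ?_⟩, ?_, ?_⟩
  · intro e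
    have : A' ∈ ({A, B} : Finset (Finset Square)) := e ▸ Finset.mem_insert_self _ _
    rw [Finset.mem_insert, Finset.mem_singleton] at this
    exact this.elim hAA' hAB'
  · intro t ht
    rw [Finset.mem_insert, Finset.mem_singleton] at ht
    rcases ht with rfl | rfl
    exacts [hAt, hBt]
  · intro t ht
    rw [Finset.mem_insert, Finset.mem_singleton] at ht
    rw [hβ]
    tauto
  · ext t
    rw [Finset.mem_sdiff (s := β.tiles), hβ, Finset.mem_insert, Finset.mem_singleton]
    change t ∈ T ↔ _
    constructor
    · exact fun ht => ⟨.inr (.inr ht), by rintro (rfl | rfl); exacts [hA'T ht, hB'T ht]⟩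
    · tauto
  · intro t h1 h2
    rw [hβ, ← hT]
    tauto
  · intro hl
    exact leftOf_of_pos_lt hah hbl (near_of_level_eq (la.trans lb.symm))
      (hl.pos_lt hAs hBs hd ha hb (near_of_level_eq (la.trans lb.symm)))
  · intro hl
    exact leftOf_of_pos_lt hbl hah (near_of_level_eq (lb.trans la.symm))
      (hl.pos_lt hBs hAs hd.symm hb ha (near_of_level_eq (lb.trans la.symm)))

/-! ### The effect of an exchange on the graph -/

theorem Tiling.not_leftOf_cycle (hn : 1 ≤ n) (α : Tiling n R) {A B C : Finset Square}
    (hA : A ∈ α.family) (hB : B ∈ α.family) (hC : C ∈ α.family) (hAB : A ≠ B) (hBC : B ≠ C)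
    (hCA : C ≠ A) (h1 : LeftOf A B) (h2 : LeftOf B C) (h3 : LeftOf C A) : False :=
  (α.isStrandFamily hn).acyclic (α.family_finite hn) A
    (((Relation.TransGen.single ⟨hA, hB, hAB, h1⟩).tail ⟨hB, hC, hBC, h2⟩).tail ⟨hC, hA, hCA, h3⟩)

/-- A strand `X'` cut out of `X ∪ Y`, with the levels of `X`, compares like `X` with every object
that is not between `X` and `Y`. -/
theorem leftOf_iff_of_subset_union {a b p q : ℤ} {X X' Y C : Finset Square} (hab : a ≤ b)
    (hpq : p ≤ q) (hX : IsStrand a b X) (hX' : IsStrand a b X')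
    (hC : IsStrand p q C) (hsub : X' ⊆ X ∪ Y) (hXC : Disjoint X C) (hYC : Disjoint Y C)
    (h1 : ¬ (LeftOf X C ∧ LeftOf C Y)) (h2 : ¬ (LeftOf Y C ∧ LeftOf C X)) :
    (LeftOf C X' ↔ LeftOf C X) ∧ (LeftOf X' C ↔ LeftOf X C) := by
  have hX'C : Disjoint X' C :=
    Finset.disjoint_of_subset_left hsub (Finset.disjoint_union_left.2 ⟨hXC, hYC⟩)
  have comparable : a ≤ q + 1 → p ≤ b + 1 → LeftOf X C ∨ LeftOf C X := fun g1 g2 => by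
    obtain ⟨s, hs, t, ht, hst⟩ := hX.exists_near hC hab hpq g1 g2
    exact leftOf_or hXC hs ht hst
  have comparable' : a ≤ q + 1 → p ≤ b + 1 → LeftOf X' C ∨ LeftOf C X' := fun g1 g2 => by
    obtain ⟨s, hs, t, ht, hst⟩ := hX'.exists_near hC hab hpq g1 g2
    exact leftOf_or hX'C hs ht hst
  have i : LeftOf C X' → LeftOf C X := fun h => by
    have hb := h.bounds hC hX'
    obtain ⟨s, hs, t, ht, hst⟩ := h
    rcases Finset.mem_union.1 (hsub ht) with ht | ht
    · exact ⟨s, hs, t, ht, hst⟩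
    · exact (comparable hb.2 hb.1).resolve_left fun hl => h1 ⟨hl, s, hs, t, ht, hst⟩
  have j : LeftOf X' C → LeftOf X C := fun h => by
    have hb := h.bounds hX' hC
    obtain ⟨s, hs, t, ht, hst⟩ := h
    rcases Finset.mem_union.1 (hsub hs) with hs | hs
    · exact ⟨s, hs, t, ht, hst⟩
    · exact (comparable hb.1 hb.2).resolve_right fun hl => h2 ⟨⟨s, hs, t, ht, hst⟩, hl⟩
  refine ⟨⟨i, fun h => ?_⟩, ⟨j, fun h => ?_⟩⟩
  · have hb := h.bounds hC hX
    exact (comparable' hb.2 hb.1).resolve_left fun hl => (j hl).asymm hX hC hXC h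
  · have hb := h.bounds hX hC
    exact (comparable' hb.1 hb.2).resolve_right fun hl => (i hl).asymm hC hX hXC.symm h

open Classical in
/-- The correspondence of objects in an exchange. -/
noncomputable def exchangeMap (A B A' B' X : Finset Square) : Finset Square :=
  if X = A then A' else if X = B then B' else X

theorem IsExchange.exists_eq_exchangeMap {α β : Tiling n R} {c d : ℤ} {A B A' B' : Finset Square}
    (h : IsExchange α β c d A B A' B') (t : Finset Square) (ht : t ∈ β.tiles) :
    ∃ u ∈ α.tiles, exchangeMap A B A' B' u = t := by
  by_cases h1 : t = A'
  · exact ⟨A, (Tiling.mem_levelTiles.1 h.left).1, by simp [exchangeMap, h1]⟩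
  by_cases h2 : t = B'
  · exact ⟨B, (Tiling.mem_levelTiles.1 h.right).1, by simp [exchangeMap, h2, h.ne.symm]⟩
  · obtain ⟨g1, g2, g3⟩ := (h.mem_iff t h1 h2).1 ht
    exact ⟨t, g1, by simp [exchangeMap, g2, g3]⟩

theorem IsExchange.exchangeMap_mem {α β : Tiling n R} {c d : ℤ}
    {A B A' B' : Finset Square} (h : IsExchange α β c d A B A' B') (hn : 1 ≤ n)
    {t : Finset Square} {e : ℤ} (ht : t ∈ α.levelTiles e) :
    exchangeMap A B A' B' t ∈ β.levelTiles e := by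
  unfold exchangeMap
  by_cases h1 : t = A
  · subst h1
    rw [if_pos rfl, (Tiling.mem_levelTiles.1 ht).2.unique (Tiling.mem_levelTiles.1 h.left).2]
    exact h.left'
  by_cases h2 : t = B
  · subst h2
    rw [if_neg h1, if_pos rfl,
      (Tiling.mem_levelTiles.1 ht).2.unique (Tiling.mem_levelTiles.1 h.right).2]
    exact h.right'
  · rw [if_neg h1, if_neg h2]
    obtain ⟨htt, hte⟩ := Tiling.mem_levelTiles.1 ht
    obtain ⟨s, hs⟩ := (α.isStrand hn ht).nonempty (by omega)
    have hs' : s ∉ A' ∪ B' := by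
      rw [h.union_eq, Finset.mem_union]
      rintro (hs' | hs')
      · exact Finset.disjoint_left.1
          (α.pairwiseDisjoint t htt A (Tiling.mem_levelTiles.1 h.left).1 h1) hs hs'
      · exact Finset.disjoint_left.1
          (α.pairwiseDisjoint t htt B (Tiling.mem_levelTiles.1 h.right).1 h2) hs hs'
    rw [Finset.mem_union, not_or] at hs'
    refine Tiling.mem_levelTiles.2 ⟨(h.mem_iff t ?_ ?_).2 ⟨htt, h1, h2⟩, hte⟩
    · rintro rfl; exact hs'.1 hs
    · rintro rfl; exact hs'.2 hs

/-- Exchanging two consecutive tiles affects no comparison except theirs. -/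
theorem IsExchange.leftOf_iff (hn : 1 ≤ n) {α β : Tiling n R} {c d : ℤ}
    {A B A' B' : Finset Square} (h : IsExchange α β c d A B A' B') (hc : α.Consecutive A B)
    {X Y : Finset Square} (hX : X ∈ α.family) (hY : Y ∈ α.family) (hXY : X ≠ Y)
    (h1 : ¬ (X = A ∧ Y = B)) (h2 : ¬ (X = B ∧ Y = A)) :
    LeftOf (exchangeMap A B A' B' X) (exchangeMap A B A' B' Y) ↔ LeftOf X Y := by
  have hAs := α.isStrand hn h.left
  have hBs := α.isStrand hn h.right
  have hA's := β.isStrand hn h.left'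
  have hB's := β.isStrand hn h.right'
  have hAf : A ∈ α.family := (Tiling.mem_family_iff hn).2 (.inl hc.left)
  have hBf : B ∈ α.family := (Tiling.mem_family_iff hn).2 (.inl hc.right)
  have hF := α.isStrandFamily hn
  have hAA : exchangeMap A B A' B' A = A' := by simp [exchangeMap]
  have hBB : exchangeMap A B A' B' B = B' := by simp [exchangeMap, hc.ne.symm]
  have hCC : ∀ C, C ≠ A → C ≠ B → exchangeMap A B A' B' C = C := fun C g1 g2 => by
    simp [exchangeMap, g1, g2]
  have hsubA : A' ⊆ A ∪ B := h.union_eq ▸ Finset.subset_union_left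
  have hsubB : B' ⊆ B ∪ A := by
    rw [Finset.union_comm, ← h.union_eq]; exact Finset.subset_union_right
  have no1 : ∀ C ∈ α.family, C ≠ A → C ≠ B → ¬ (LeftOf A C ∧ LeftOf C B) := hc.not_between
  have no2 : ∀ C ∈ α.family, C ≠ A → C ≠ B → ¬ (LeftOf B C ∧ LeftOf C A) :=
    fun C hC g1 g2 g => α.not_leftOf_cycle hn hAf hBf hC hc.ne g2.symm g1 hc.leftOf g.1 g.2
  have keyA : ∀ C ∈ α.family, C ≠ A → C ≠ B →
      (LeftOf C A' ↔ LeftOf C A) ∧ (LeftOf A' C ↔ LeftOf A C) := by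
    intro C hC g1 g2
    obtain ⟨p, q, hpq, hCs⟩ := hF.isStrand C hC
    exact leftOf_iff_of_subset_union (by omega) hpq hAs hA's hCs hsubA
      (hF.disjoint _ hAf _ hC g1.symm) (hF.disjoint _ hBf _ hC g2.symm) (no1 C hC g1 g2)
      (no2 C hC g1 g2)
  have keyB : ∀ C ∈ α.family, C ≠ A → C ≠ B →
      (LeftOf C B' ↔ LeftOf C B) ∧ (LeftOf B' C ↔ LeftOf B C) := by
    intro C hC g1 g2
    obtain ⟨p, q, hpq, hCs⟩ := hF.isStrand C hC
    exact leftOf_iff_of_subset_union (by omega) hpq hBs hB's hCs hsubB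
      (hF.disjoint _ hBf _ hC g2.symm) (hF.disjoint _ hAf _ hC g1.symm) (no2 C hC g1 g2)
      (no1 C hC g1 g2)
  by_cases hXA : X = A
  · subst hXA
    have hYB : Y ≠ B := fun e => h1 ⟨rfl, e⟩
    rw [hAA, hCC Y hXY.symm hYB]
    exact (keyA Y hY hXY.symm hYB).2
  by_cases hXB : X = B
  · subst hXB
    have hYA : Y ≠ A := fun e => h2 ⟨rfl, e⟩
    rw [hBB, hCC Y hYA hXY.symm]
    exact (keyB Y hY hYA hXY.symm).2
  rw [hCC X hXA hXB]
  by_cases hYA : Y = A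
  · subst hYA
    rw [hAA]
    exact (keyA X hX hXA hXB).1
  by_cases hYB : Y = B
  · subst hYB
    rw [hBB]
    exact (keyB X hX hXA hXB).1
  rw [hCC Y hYA hYB]

theorem IsExchange.exchangeMap_injOn (hn : 1 ≤ n) {α β : Tiling n R} {c d : ℤ}
    {A B A' B' : Finset Square} (h : IsExchange α β c d A B A' B') :
    Set.InjOn (exchangeMap A B A' B') α.tiles := by
  have hAt := (Tiling.mem_levelTiles.1 h.left).1
  have hBt := (Tiling.mem_levelTiles.1 h.right).1
  have hA's := β.isStrand hn h.left'
  have hB's := β.isStrand hn h.right'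
  have hne' : A' ≠ B' := by
    rintro e
    have := (Tiling.mem_levelTiles.1 h.left').2
    rw [e] at this
    exact h.levels_ne (this.unique (Tiling.mem_levelTiles.1 h.right').2)
  have new : ∀ t ∈ α.tiles, t ≠ A → t ≠ B → t ≠ A' ∧ t ≠ B' := by
    intro t ht h1 h2
    have hd : Disjoint t (A' ∪ B') := by
      rw [h.union_eq, Finset.disjoint_union_right]
      exact ⟨α.pairwiseDisjoint t ht A hAt h1, α.pairwiseDisjoint t ht B hBt h2⟩
    rw [Finset.disjoint_union_right] at hd
    obtain ⟨s, hs⟩ := hA's.nonempty (by omega)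
    obtain ⟨r, hr⟩ := hB's.nonempty (by omega)
    constructor
    · rintro rfl; exact Finset.disjoint_left.1 hd.1 hs hs
    · rintro rfl; exact Finset.disjoint_left.1 hd.2 hr hr
  intro x hx y hy hxy
  unfold exchangeMap at hxy
  split_ifs at hxy with g1 g2 g3 g4 g5 g6
  · rw [g1, g2]
  · exact absurd hxy hne'
  · exact absurd hxy.symm (new y hy g2 g3).1
  · exact absurd hxy.symm hne'
  · rw [g4, g6]
  all_goals first
    | exact hxy
    | exact absurd hxy (new x hx ‹_› ‹_›).1
    | exact absurd hxy (new x hx ‹_› ‹_›).2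
    | exact absurd hxy.symm (new y hy ‹_› ‹_›).2

/-- The exchange preserves the order of the tiles of each level, hence their names. -/
theorem IsExchange.represents (hn : 1 ≤ n) {α β : Tiling n R} {c d : ℤ}
    {A B A' B' : Finset Square} (h : IsExchange α β c d A B A' B') (hc : α.Consecutive A B)
    {v : GVertex} {X : Finset Square} (hX : Represents α v X) :
    Represents β v (exchangeMap A B A' B' X) := by
  cases v with
  | square s =>
    obtain ⟨hs, rfl⟩ := hX
    have : ∀ t ∈ α.tiles, {s} ≠ t := by
      rintro t ht rfl
      exact hs.1 (α.mem_region ht (Finset.mem_singleton_self s))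
    exact ⟨hs, by simp [exchangeMap, this A hc.left, this B hc.right]⟩
  | tile e i =>
    obtain ⟨hX1, hX2, hi⟩ := hX
    have hXl := Tiling.mem_levelTiles.2 ⟨hX1, hX2⟩
    have hσ := Tiling.mem_levelTiles.1 (h.exchangeMap_mem hn hXl)
    refine ⟨hσ.1, hσ.2, ?_⟩
    rw [← hi]
    congr 1
    have himg : {t' | t' ∈ β.tiles ∧ HasLevel t' e ∧ t' ≠ exchangeMap A B A' B' X ∧
        LeftOf t' (exchangeMap A B A' B' X)} = exchangeMap A B A' B' ''
          {t' | t' ∈ α.tiles ∧ HasLevel t' e ∧ t' ≠ X ∧ LeftOf t' X} := by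
      have key : ∀ u ∈ α.levelTiles e, u ≠ X →
          (LeftOf (exchangeMap A B A' B' u) (exchangeMap A B A' B' X) ↔ LeftOf u X) := by
        intro u hu hne
        have mem := fun t (ht : t ∈ α.tiles) => (Tiling.mem_family_iff (α := α) hn).2 (.inl ht)
        refine h.leftOf_iff hn hc (mem u (Tiling.mem_levelTiles.1 hu).1) (mem X hX1) hne ?_ ?_
        -- The two exchanged tiles have different levels.
        · rintro ⟨rfl, rfl⟩
          exact h.levels_ne (((Tiling.mem_levelTiles.1 h.left).2.unique
            (Tiling.mem_levelTiles.1 hu).2).trans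
            (hX2.unique (Tiling.mem_levelTiles.1 h.right).2))
        · rintro ⟨rfl, rfl⟩
          exact h.levels_ne ((Tiling.mem_levelTiles.1 h.left).2.unique hX2 |>.trans
            ((Tiling.mem_levelTiles.1 hu).2.unique (Tiling.mem_levelTiles.1 h.right).2))
      ext t
      constructor
      · rintro ⟨ht, hte, htX, htl⟩
        obtain ⟨u, hu, rfl⟩ := h.exists_eq_exchangeMap t ht
        obtain ⟨e', he'⟩ := α.exists_levelTiles hn hu
        obtain rfl := (Tiling.mem_levelTiles.1 (h.exchangeMap_mem hn he')).2.unique hte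
        have huX : u ≠ X := by rintro rfl; exact htX rfl
        exact ⟨u, ⟨hu, (Tiling.mem_levelTiles.1 he').2, huX, (key u he' huX).1 htl⟩, rfl⟩
      · rintro ⟨u, ⟨hu, hue, huX, hul⟩, rfl⟩
        have hul' := Tiling.mem_levelTiles.2 ⟨hu, hue⟩
        have hm := Tiling.mem_levelTiles.1 (h.exchangeMap_mem hn hul')
        exact ⟨hm.1, hm.2, fun e => huX (h.exchangeMap_injOn hn hu hX1 e), (key u hul' huX).2 hul⟩
    rw [himg]
    exact ((h.exchangeMap_injOn hn).mono fun u hu => hu.1).ncard_image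

/-- Exchanging two consecutive tiles so that they change sides reverses their edge and no other. -/
theorem IsExchange.edgeReversal (hn : 1 ≤ n) (hR : IsRegion R) (hsc : IsSimplyConnected R)
    {α β : Tiling n R} {c d : ℤ} {A B A' B' : Finset Square}
    (h : IsExchange α β c d A B A' B') (hc : α.Consecutive A B) (hrev : LeftOf B' A')
    {v w : GVertex} (hv : Represents α v A) (hw : Represents α w B) :
    (tilingGraph α).Arc v w ∧ (tilingGraph β).Arc w v ∧
      ∀ x y, s(x, y) ≠ s(v, w) → ((tilingGraph α).Arc x y ↔ (tilingGraph β).Arc x y) := by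
  have hvw : v ≠ w := by
    rintro rfl
    exact hc.ne (hv.unique hn hw)
  have hv' := h.represents hn hc hv
  have hw' := h.represents hn hc hw
  have hA : exchangeMap A B A' B' A = A' := by simp [exchangeMap]
  have hB : exchangeMap A B A' B' B = B' := by simp [exchangeMap, hc.ne.symm]
  refine ⟨⟨hvw, A, B, hv, hw, hc.leftOf⟩, ⟨hvw.symm, B', A', hB ▸ hw', hA ▸ hv', hrev⟩, ?_⟩
  intro x y hxy
  have key : ∀ {X Y}, Represents α x X → Represents α y Y → x ≠ y →
      (LeftOf (exchangeMap A B A' B' X) (exchangeMap A B A' B' Y) ↔ LeftOf X Y) := by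
    intro X Y hX hY hne
    refine h.leftOf_iff hn hc ⟨x, hX⟩ ⟨y, hY⟩ (by rintro rfl; exact hne (hX.inj hn hY)) ?_ ?_
    · rintro ⟨rfl, rfl⟩
      exact hxy (by rw [hX.inj hn hv, hY.inj hn hw])
    · rintro ⟨rfl, rfl⟩
      exact hxy (by rw [hX.inj hn hw, hY.inj hn hv, Sym2.eq_swap])
  constructor
  · rintro ⟨hne, X, Y, hX, hY, hl⟩
    exact ⟨hne, _, _, h.represents hn hc hX, h.represents hn hc hY, (key hX hY hne).2 hl⟩
  · rintro ⟨hne, X', Y', hX', hY', hl⟩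
    obtain ⟨X, hX⟩ := (exists_represents_iff hn hR hsc α β x).2 ⟨X', hX'⟩
    obtain ⟨Y, hY⟩ := (exists_represents_iff hn hR hsc α β y).2 ⟨Y', hY'⟩
    rw [hX'.unique hn (h.represents hn hc hX), hY'.unique hn (h.represents hn hc hY)] at hl
    exact ⟨hne, X, Y, hX, hY, (key hX hY hne).1 hl⟩

end

section
variable {n : ℕ} {R : Finset Square}

/-! ### Reversing a free edge -/

/-- A free edge of the graph of `α` that is the only directed path of length at most two between
its ends can be reversed by a local replacement move. -/
theorem exists_localMove_of_arc (hn : 1 ≤ n) (hR : IsRegion R) (hsc : IsSimplyConnected R)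
    {α : Tiling n R} {v w : GVertex} (h : (tilingGraph α).Arc v w) (hf : ¬ IsForcedPair n v w)
    (hbet : ∀ x, (tilingGraph α).Arc v x → ¬ (tilingGraph α).Arc x w) :
    ∃ β : Tiling n R, LocalMove α β ∧ (tilingGraph β).Arc w v ∧
      ∀ x y, s(x, y) ≠ s(v, w) → ((tilingGraph α).Arc x y ↔ (tilingGraph β).Arc x y) := by
  obtain ⟨c, i, rfl⟩ : ∃ c i, v = .tile c i := by
    cases v with
    | tile c i => exact ⟨c, i, rfl⟩
    | square s => exact absurd trivial hf
  obtain ⟨d, j, rfl⟩ : ∃ d j, w = .tile d j := by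
    cases w with
    | tile d j => exact ⟨d, j, rfl⟩
    | square s => exact absurd trivial hf
  replace hf : ¬ c ≡ d [ZMOD n] := hf
  have h' := h
  obtain ⟨hne, A, B, hA, hB, hl⟩ := h
  have hb := hl.bounds (hA.isStrand hn) (hB.isStrand hn)
  simp only [GVertex.lo, GVertex.hi] at hb
  have h1 : c ≠ d := by rintro rfl; exact hf rfl
  have h2 : c ≠ d + n := by rintro rfl; exact hf (by simp [Int.ModEq])
  have h3 : d ≠ c + n := by rintro rfl; exact hf (by simp [Int.ModEq])
  have hAl := ((isTileAt_iff hn).1 hA).1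
  have hBl := ((isTileAt_iff hn).1 hB).1
  have hc : α.Consecutive A B := by
    refine ⟨hA.mem_tiles, hB.mem_tiles, fun e => hne (hA.inj hn (e ▸ hB)), hl, ?_⟩
    rintro C ⟨x, hx⟩ hCA hCB ⟨g1, g2⟩
    refine hbet x ((hA.arc_iff hn hx).2 ⟨?_, g1⟩) ((hx.arc_iff hn hB).2 ⟨?_, g2⟩)
    · rintro rfl; exact hCA (hx.unique hn hA)
    · rintro rfl; exact hCB (hx.unique hn hB)
  rcases lt_or_gt_of_ne h1 with hlt | hlt
  · obtain ⟨β, hm, A', B', he, hr, -⟩ := exists_swap hn hAl hBl hlt (by omega) (.inl hc)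
    exact ⟨β, hm, (he.edgeReversal hn hR hsc hc (hr hl) hA hB).2⟩
  · obtain ⟨β, hm, B', A', he, -, hr⟩ := exists_swap hn hBl hAl hlt (by omega) (.inr hc)
    exact ⟨β, hm, (he.symm.edgeReversal hn hR hsc hc (hr hl) hA hB).2⟩

theorem tilingGraph_verts_finite (hn : 1 ≤ n) (α : Tiling n R) :
    (tilingGraph α).verts.Finite := by
  classical
  have hname : ∀ A : Finset Square, ∃ v, (∃ w, Represents α w A) → Represents α v A := fun A => by
    by_cases h : ∃ w, Represents α w A
    · exact ⟨h.choose, fun _ => h.choose_spec⟩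
    · exact ⟨.square 0, fun h' => absurd h' h⟩
  choose name hname using hname
  refine ((α.family_finite hn).image name).subset ?_
  rintro v ⟨A, hA⟩
  exact ⟨A, ⟨v, hA⟩, (hname A ⟨v, hA⟩).inj hn hA⟩

theorem mem_verts_of_arc {α : Tiling n R} {v w : GVertex} (h : (tilingGraph α).Arc v w) :
    v ∈ (tilingGraph α).verts ∧ w ∈ (tilingGraph α).verts := by
  obtain ⟨-, A, B, hA, hB, -⟩ := h
  exact ⟨⟨A, hA⟩, ⟨B, hB⟩⟩

/-- The vertices can be numbered increasingly along the edges. -/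
theorem exists_numbering (hn : 1 ≤ n) (α : Tiling n R) :
    ∃ r : GVertex → ℕ, ∀ v w, (tilingGraph α).Arc v w → r v < r w := by
  refine ⟨fun v => {x | x ∈ (tilingGraph α).verts ∧
    Relation.TransGen (tilingGraph α).Arc x v}.ncard, fun v w h => ?_⟩
  refine Set.ncard_lt_ncard ⟨fun x hx => ⟨hx.1, hx.2.tail h⟩, fun hsub => ?_⟩
    ((tilingGraph_verts_finite hn α).subset fun x hx => hx.1)
  exact tilingGraph_isAcyclic hn α v
    (hsub ⟨(mem_verts_of_arc h).1, Relation.TransGen.single h⟩ : _ ∧ _).2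

/-! ### Every acyclic orientation comes from a tiling -/

/-- The edges of the graph of `α` that have the opposite direction in `O`. -/
def disagreement (α : Tiling n R) (O : OrientedGraph GVertex) : Set (GVertex × GVertex) :=
  {e | (tilingGraph α).Arc e.1 e.2 ∧ O.Arc e.2 e.1}

theorem disagreement_finite (hn : 1 ≤ n) (α : Tiling n R) (O : OrientedGraph GVertex) :
    (disagreement α O).Finite :=
  ((tilingGraph_verts_finite hn α).prod (tilingGraph_verts_finite hn α)).subset fun _ h =>
    mem_verts_of_arc h.1

theorem not_arc_of_arc {O : OrientedGraph GVertex} (hO : O.IsAcyclic) {v w : GVertex}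
    (h : O.Arc v w) : ¬ O.Arc w v := fun h' => hO v ((Relation.TransGen.single h).tail h')

theorem arc_or_of_mem {O : OrientedGraph GVertex} (hO : O ∈ acyclicExtensions n R)
    {α : Tiling n R} {v w : GVertex} (h : (tilingGraph α).Arc v w) : O.Arc v w ∨ O.Arc w v :=
  (hO.1.2.2 v w ⟨α, .inl h⟩).or

theorem tilingGraph_eq_of_disagreement_eq_empty (hn : 1 ≤ n) (hR : IsRegion R)
    (hsc : IsSimplyConnected R) {α : Tiling n R} {O : OrientedGraph GVertex}
    (hO : O ∈ acyclicExtensions n R) (h : disagreement α O = ∅) : tilingGraph α = O := by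
  have hα := tilingGraph_mem_acyclicExtensions hn hR hsc α
  have hno : ∀ x y, (tilingGraph α).Arc x y → ¬ O.Arc y x := fun x y h1 h2 =>
    Set.eq_empty_iff_forall_notMem.1 h (x, y) ⟨h1, h2⟩
  apply OrientedGraph.ext
  · rw [hα.1.1, hO.1.1]
  · funext x y
    refine propext ⟨fun hxy => ?_, fun hxy => ?_⟩
    · exact (arc_or_of_mem hO hxy).resolve_right (hno x y hxy)
    · exact (hα.1.2.2 x y (hO.1.2.1 x y hxy)).or.resolve_right fun hyx => hno y x hyx hxy

/-- Reversing a suitable edge on which `α` and `O` disagree brings the tiling closer to `O`. -/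
theorem exists_disagreement_ssubset (hn : 1 ≤ n) (hR : IsRegion R) (hsc : IsSimplyConnected R)
    {α : Tiling n R} {O : OrientedGraph GVertex} (hO : O ∈ acyclicExtensions n R)
    (h : (disagreement α O).Nonempty) :
    ∃ β : Tiling n R, disagreement β O ⊂ disagreement α O := by
  obtain ⟨r, hr⟩ := exists_numbering hn α
  -- A shortest disagreeing edge, measured by the numbering, has no vertex between its ends.
  obtain ⟨⟨v, w⟩, ⟨hvw, hwv⟩, hmin⟩ := (disagreement_finite hn α O).exists_minimalFor
    (fun e => r e.2 - r e.1) _ h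
  simp only at hvw hwv
  have hmin' : ∀ x y, (tilingGraph α).Arc x y → O.Arc y x → r w - r v ≤ r y - r x := by
    intro x y h1 h2
    by_contra hlt
    have := hmin (j := (x, y)) ⟨h1, h2⟩ (by simp only; omega)
    simp only at this
    omega
  have hf : ¬ IsForcedPair n v w := fun hf =>
    not_arc_of_arc hO.2.2 hwv (hO.2.1 v w ⟨hf, α, hvw⟩)
  obtain ⟨β, -, hβ, hagree⟩ := exists_localMove_of_arc hn hR hsc hvw hf (by
    intro x hvx hxw
    have l1 := hr _ _ hvx
    have l2 := hr _ _ hxw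
    rcases arc_or_of_mem hO hvx with g1 | g1
    · rcases arc_or_of_mem hO hxw with g2 | g2
      · exact hO.2.2 v (((Relation.TransGen.single g1).tail g2).tail hwv)
      · have := hmin' x w hxw g2
        omega
    · have := hmin' v x hvx g1
      omega)
  refine ⟨β, fun ⟨x, y⟩ ⟨hxy, hyx⟩ => ?_, fun hsub => ?_⟩
  swap
  · have hmem : (v, w) ∈ disagreement β O := hsub ⟨hvw, hwv⟩
    exact tilingGraph_arc_asymm hn β hβ hmem.1
  simp only at hxy hyx
  refine ⟨(hagree x y fun e => ?_).2 hxy, hyx⟩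
  rcases Sym2.eq_iff.1 e with ⟨rfl, rfl⟩ | ⟨rfl, rfl⟩
  · exact tilingGraph_arc_asymm hn β hβ hxy
  · exact not_arc_of_arc hO.2.2 hwv hyx

theorem exists_tilingGraph_eq (hn : 1 ≤ n) (hR : IsRegion R) (hsc : IsSimplyConnected R)
    {O : OrientedGraph GVertex} (hO : O ∈ acyclicExtensions n R) (α : Tiling n R) :
    ∃ β : Tiling n R, tilingGraph β = O := by
  induction hm : (disagreement α O).ncard using Nat.strong_induction_on generalizing α with
  | _ m ih =>
    rcases (disagreement α O).eq_empty_or_nonempty with h | h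
    · exact ⟨α, tilingGraph_eq_of_disagreement_eq_empty hn hR hsc hO h⟩
    · obtain ⟨β, hβ⟩ := exists_disagreement_ssubset hn hR hsc hO h
      exact ih _ (hm ▸ Set.ncard_lt_ncard hβ (disagreement_finite hn α O)) β rfl

/-! ### Edge reversals are local replacement moves -/

theorem localMove_of_edgeReversal (hn : 1 ≤ n) (hR : IsRegion R) (hsc : IsSimplyConnected R)
    {α β : Tiling n R} (h : (tilingGraph α).EdgeReversal (tilingGraph β)) : LocalMove α β := by
  obtain ⟨v, w, hα, hβ, hα', hβ', hagree⟩ := h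
  have hf : ¬ IsForcedPair n v w := fun hf => hβ' (arc_of_isForcedPair hn hR hsc hf hα)
  obtain ⟨γ, hm, hγ, hγ'⟩ := exists_localMove_of_arc hn hR hsc hα hf (by
    intro x hvx hxw
    have n1 : s(v, x) ≠ s(v, w) := fun e => by
      rcases Sym2.eq_iff.1 e with ⟨-, rfl⟩ | ⟨-, rfl⟩
      · exact hxw.1 rfl
      · exact hvx.1 rfl
    have n2 : s(x, w) ≠ s(v, w) := fun e => by
      rcases Sym2.eq_iff.1 e with ⟨rfl, -⟩ | ⟨rfl, -⟩
      · exact hvx.1 rfl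
      · exact hxw.1 rfl
    exact tilingGraph_isAcyclic hn β v ((((Relation.TransGen.single
      ((hagree _ _ n1).1 hvx))).tail ((hagree _ _ n2).1 hxw)).tail hβ))
  have : γ = β := by
    apply tilingGraph_injective hn
    apply OrientedGraph.ext
    · exact (tilingGraph_mem_acyclicExtensions hn hR hsc γ).1.1.trans
        (tilingGraph_mem_acyclicExtensions hn hR hsc β).1.1.symm
    · funext x y
      apply propext
      by_cases e : s(x, y) = s(v, w)
      · rcases Sym2.eq_iff.1 e with ⟨rfl, rfl⟩ | ⟨rfl, rfl⟩
        · exact iff_of_false (tilingGraph_arc_asymm hn γ hγ) hβ'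
        · exact iff_of_true hγ hβ
      · rw [← hγ' x y e, hagree x y e]
  exact this ▸ hm

/-! ### Retiling the union of two tiles -/

/-- Two strands with the same union as `A` and `B` cannot change over between `A` and `B` at two
consecutive levels at which both are present. -/
theorem IsStrand.mem_of_mem_below {a₁ a₂ b₁ b₂ a₁' a₂' b₁' b₂' k : ℤ} {A B A' B' : Finset Square}
    (hA : IsStrand a₁ a₂ A) (hB : IsStrand b₁ b₂ B) (hA' : IsStrand a₁' a₂' A')
    (hB' : IsStrand b₁' b₂' B') (hd : Disjoint A B) (hun : A' ∪ B' = A ∪ B)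
    (hak : a₁ ≤ k) (hka : k + 1 ≤ a₂) (hbk : b₁ ≤ k) (hkb : k + 1 ≤ b₂) {s t : Square}
    (hsA' : s ∈ A') (hsA : s ∈ A) (hs : level s = k) (htA' : t ∈ A') (ht : level t = k + 1) :
    t ∈ A := by
  rcases Finset.mem_union.1 (hun ▸ Finset.mem_union_left B' htA') with h | htB
  · exact h
  exfalso
  obtain ⟨a, ha, la⟩ := hA.exists_mem (k + 1) (by omega) hka
  obtain ⟨b, hb, lb⟩ := hB.exists_mem k hbk (by omega)
  have haB' : a ∈ B' := by
    refine (Finset.mem_union.1 (hun.symm ▸ Finset.mem_union_left B ha)).resolve_left fun h => ?_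
    have := hA'.unique a h t htA' (by omega)
    exact Finset.disjoint_left.1 hd ha (this ▸ htB)
  have hbB' : b ∈ B' := by
    refine (Finset.mem_union.1 (hun.symm ▸ Finset.mem_union_right A hb)).resolve_left fun h => ?_
    have := hA'.unique b h s hsA' (by omega)
    exact Finset.disjoint_left.1 hd (this ▸ hsA) hb
  have e1 := hA.step s hsA a ha (by omega)
  have e2 := hB.step b hb t htB (by omega)
  have e3 := hA'.step s hsA' t htA' (by omega)
  have e4 := hB'.step b hbB' a haB' (by omega)
  have n1 : pos s ≠ pos b := fun e => Finset.disjoint_left.1 hd hsA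
    (eq_of_level_pos (by omega) e ▸ hb)
  have n2 : pos a ≠ pos t := fun e => Finset.disjoint_left.1 hd ha
    (eq_of_level_pos (by omega) e ▸ htB)
  omega

theorem IsStrand.mem_of_mem_of_le {a₁ a₂ b₁ b₂ a₁' a₂' b₁' b₂' k m : ℤ}
    {A B A' B' : Finset Square}
    (hA : IsStrand a₁ a₂ A) (hB : IsStrand b₁ b₂ B) (hA' : IsStrand a₁' a₂' A')
    (hB' : IsStrand b₁' b₂' B') (hd : Disjoint A B) (hun : A' ∪ B' = A ∪ B)
    (hak : a₁ ≤ k) (hbk : b₁ ≤ k) (hak' : a₁' ≤ k) (hkm : k ≤ m) (hma : m ≤ a₂) (hmb : m ≤ b₂)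
    (hma' : m ≤ a₂') {s : Square} (hsA' : s ∈ A') (hsA : s ∈ A) (hs : level s = k) {t : Square}
    (htA' : t ∈ A') (ht : level t = m) : t ∈ A := by
  induction m, hkm using Int.leInduction generalizing t with
  | base => exact hA'.unique t htA' s hsA' (by omega) ▸ hsA
  | succ m hkm ih =>
    obtain ⟨r, hr, lr⟩ := hA'.exists_mem m (by omega) (by omega)
    exact hA.mem_of_mem_below hB hA' hB' hd hun (by omega) (by omega) (by omega) (by omega) hr
      (ih (by omega) (by omega) (by omega) hr lr) lr htA' ht

theorem IsStrand.eq_of_subset {a b : ℤ} {A B : Finset Square} (hA : IsStrand a b A)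
    (hB : IsStrand a b B) (h : A ⊆ B) : A = B := by
  refine h.antisymm fun s hs => ?_
  have hb := hB.bounds s hs
  obtain ⟨r, hr, lr⟩ := hA.exists_mem (level s) hb.1 hb.2
  exact hB.unique r (h hr) s hs lr ▸ hr

theorem eq_of_union_eq {A B A' B' : Finset Square} (hd : Disjoint A B) (hd' : Disjoint A' B')
    (hun : A' ∪ B' = A ∪ B) (h : A' = A) : B' = B := by
  subst h
  ext s
  have h1 : s ∈ A' → s ∉ B := fun h => Finset.disjoint_left.1 hd h
  have h2 : s ∈ A' → s ∉ B' := fun h => Finset.disjoint_left.1 hd' h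
  have h3 : s ∈ A' ∪ B' ↔ s ∈ A' ∪ B := by rw [hun]
  rw [Finset.mem_union, Finset.mem_union] at h3
  tauto

/-- A different decomposition of the union of two tiles of levels `c ≤ d` exists only if `c < d`
and the tiles overlap; then it exchanges the two tiles at all their common levels. -/
theorem crossing_of_union_eq {c d : ℤ} {A B A' B' : Finset Square}
    (hA : IsStrand c (c + n - 1) A) (hB : IsStrand d (d + n - 1) B)
    (hA' : IsStrand c (c + n - 1) A') (hB' : IsStrand d (d + n - 1) B') (hcd : c ≤ d)
    (hd : Disjoint A B) (hd' : Disjoint A' B') (hun : A' ∪ B' = A ∪ B)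
    (hne : ({A, B} : Finset (Finset Square)) ≠ {A', B'}) :
    c < d ∧ d < c + n ∧ ∀ s, d ≤ level s → level s ≤ c + n - 1 → (s ∈ B → s ∈ A') ∧
      (s ∈ A → s ∈ B') := by
  have hAA' : A' ≠ A := fun e => hne (by rw [e, eq_of_union_eq hd hd' hun e])
  have hBA' : A' ≠ B := fun e => hne (by
    rw [e, eq_of_union_eq hd.symm hd' (hun.trans (Finset.union_comm _ _)) e, Finset.pair_comm])
  have low : ∀ s ∈ A', level s < d → s ∈ A := fun s hs hlt =>
    (Finset.mem_union.1 (hun ▸ Finset.mem_union_left B' hs)).resolve_right fun h => by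
      have := hB.bounds s h
      omega
  have hdc : d < c + n := by
    by_contra hge
    refine hAA' (hA'.eq_of_subset hA fun s hs => low s hs ?_)
    have := hA'.bounds s hs
    omega
  obtain ⟨o, ho, lo⟩ := hA'.exists_mem d (by omega) (by omega)
  have hoB : o ∈ B := by
    refine (Finset.mem_union.1 (hun ▸ Finset.mem_union_left B' ho)).resolve_left fun hoA => ?_
    refine hAA' (hA'.eq_of_subset hA fun s hs => ?_)
    have hb := hA'.bounds s hs
    rcases lt_or_ge (level s) d with hlt | hge
    · exact low s hs hlt
    · exact hA.mem_of_mem_of_le hB hA' hB' hd hun (k := d) (m := level s) (by omega) (by omega)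
        (by omega) hge (by omega) (by omega) (by omega) ho hoA lo hs rfl
  have high : ∀ s ∈ A', d ≤ level s → s ∈ B := fun s hs hge => by
    have hb := hA'.bounds s hs
    exact hB.mem_of_mem_of_le hA hA' hB' hd.symm (hun.trans (Finset.union_comm _ _)) (k := d)
      (m := level s) (by omega) (by omega) (by omega) hge (by omega) (by omega) (by omega) ho hoB lo
      hs rfl
  refine ⟨hcd.lt_of_ne ?_, hdc, fun s h1 h2 => ?_⟩
  · rintro rfl
    exact hBA' (hA'.eq_of_subset hB fun s hs => high s hs (hA'.bounds s hs).1)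
  obtain ⟨t, ht, lt⟩ := hA'.exists_mem (level s) (by omega) h2
  have htB := high t ht (by omega)
  refine ⟨fun hs => hB.unique t htB s hs lt ▸ ht, fun hs => ?_⟩
  refine (Finset.mem_union.1 (hun.symm ▸ Finset.mem_union_left B hs)).resolve_left fun hs' => ?_
  exact Finset.disjoint_left.1 hd hs (high s hs' h1)

theorem levels_eq_of_union_eq (hn : 1 ≤ n) {c d c' d' : ℤ} {A B A' B' : Finset Square}
    (hA : IsStrand c (c + n - 1) A) (hB : IsStrand d (d + n - 1) B)
    (hA' : IsStrand c' (c' + n - 1) A') (hB' : IsStrand d' (d' + n - 1) B') (hcd : c ≤ d)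
    (hcd' : c' ≤ d') (hun : A' ∪ B' = A ∪ B) : c' = c ∧ d' = d := by
  have key : ∀ {c d c' d' : ℤ} {A B A' B' : Finset Square},
      IsStrand c (c + n - 1) A → IsStrand d (d + n - 1) B →
      IsStrand c' (c' + n - 1) A' → IsStrand d' (d' + n - 1) B' → c ≤ d → c' ≤ d' →
      A' ∪ B' = A ∪ B → c' ≤ c ∧ d ≤ d' := by
    intro c d c' d' A B A' B' hA hB hA' hB' hcd hcd' hun
    obtain ⟨s, hs, ls⟩ := hA.exists_mem c le_rfl (by omega)
    obtain ⟨t, ht, lt⟩ := hB.exists_mem (d + n - 1) (by omega) le_rfl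
    have hs' := Finset.mem_union.1 (hun.symm ▸ Finset.mem_union_left B hs)
    have ht' := Finset.mem_union.1 (hun.symm ▸ Finset.mem_union_right A ht)
    constructor
    · rcases hs' with h | h
      · have := hA'.bounds s h; omega
      · have := hB'.bounds s h; omega
    · rcases ht' with h | h
      · have := hA'.bounds t h; omega
      · have := hB'.bounds t h; omega
  have h1 := key hA hB hA' hB' hcd hcd' hun
  have h2 := key hA' hB' hA hB hcd' hcd hun.symm
  omega

/-! ### Local replacement moves are edge reversals -/

theorem exists_pair_levels (hn : 1 ≤ n) {α : Tiling n R} {p : Finset (Finset Square)}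
    (hp : p.card = 2) (hsub : p ⊆ α.tiles) : ∃ A B c d, p = {A, B} ∧ A ≠ B ∧ c ≤ d ∧
      A ∈ α.levelTiles c ∧ B ∈ α.levelTiles d := by
  obtain ⟨A, B, hne, rfl⟩ := Finset.card_eq_two.1 hp
  obtain ⟨c, hc⟩ := α.exists_levelTiles hn (hsub (Finset.mem_insert_self A {B}))
  obtain ⟨d, hd⟩ := α.exists_levelTiles hn
    (hsub (Finset.mem_insert_of_mem (Finset.mem_singleton_self B)))
  rcases le_total c d with h | h
  · exact ⟨A, B, c, d, rfl, hne, h, hc, hd⟩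
  · exact ⟨B, A, d, c, Finset.pair_comm A B, hne.symm, h, hd, hc⟩

theorem mem_union_of_sdiff_eq {α β : Tiling n R} {A B A' B' : Finset Square}
    (hA : A ∈ α.tiles) (hB : B ∈ α.tiles)
    (h : α.tiles \ {A, B} = β.tiles \ {A', B'}) {s : Square} (hs : s ∈ A ∪ B) : s ∈ A' ∪ B' := by
  obtain ⟨X, hX, hXp, hsX⟩ : ∃ X ∈ α.tiles, (X = A ∨ X = B) ∧ s ∈ X := by
    rcases Finset.mem_union.1 hs with hs | hs
    · exact ⟨A, hA, .inl rfl, hs⟩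
    · exact ⟨B, hB, .inr rfl, hs⟩
  obtain ⟨t, ht, hst⟩ := β.exists_mem (α.mem_region hX hsX)
  by_cases htq : t = A' ∨ t = B'
  · rcases htq with rfl | rfl
    · exact Finset.mem_union_left _ hst
    · exact Finset.mem_union_right _ hst
  · have : t ∈ α.tiles \ {A, B} := by
      rw [h, Finset.mem_sdiff, Finset.mem_insert, Finset.mem_singleton]
      exact ⟨ht, htq⟩
    rw [Finset.mem_sdiff, Finset.mem_insert, Finset.mem_singleton] at this
    have htX : t ≠ X := by
      rintro rfl
      exact this.2 hXp
    exact absurd hsX (Finset.disjoint_left.1 (α.pairwiseDisjoint t this.1 X hX htX) hst)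

theorem isExchange_of_sdiff_eq {α β : Tiling n R} {c d : ℤ} {A B A' B' : Finset Square}
    (hA : A ∈ α.levelTiles c) (hB : B ∈ α.levelTiles d) (hA' : A' ∈ β.levelTiles c)
    (hB' : B' ∈ β.levelTiles d) (hcd : c ≠ d) (hun : A' ∪ B' = A ∪ B)
    (h : α.tiles \ {A, B} = β.tiles \ {A', B'}) : IsExchange α β c d A B A' B' := by
  refine ⟨hA, hB, hA', hB', hcd, hun, fun t h1 h2 => ?_⟩
  have := congrArg (t ∈ ·) h
  simp only [Finset.mem_sdiff, Finset.mem_insert, Finset.mem_singleton, h1, h2, or_self,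
    not_false_eq_true, and_true, not_or, eq_iff_iff] at this
  exact this.symm

/-- By the invariance of the number of tiles to the right of a boundary square, an exchange moves
no tile to the right of such a square. -/
theorem IsExchange.leftOf_square (hn : 1 ≤ n) (hR : IsRegion R) (hsc : IsSimplyConnected R)
    {α β : Tiling n R} {c d : ℤ} {A B A' B' : Finset Square}
    (h : IsExchange α β c d A B A' B') (hAA' : ¬ Disjoint A A') {r : Square} (hr : r ∉ R)
    (h1 : c ≤ level r + 1) (h2 : level r ≤ c + n) (hl : LeftOf {r} A') : LeftOf {r} A := by
  classical
  by_contra hnl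
  have hcount := countRight_eq hn hR hsc α β hr h1 h2
  refine hcount.not_lt (Finset.card_lt_card (Finset.ssubset_iff_of_subset ?_ |>.2 ⟨A', ?_, ?_⟩))
  · intro t ht
    obtain ⟨ht, hlt⟩ := Finset.mem_filter.1 ht
    have htA : t ≠ A := by rintro rfl; exact hnl hlt
    have htB : t ≠ B := by
      rintro rfl
      exact h.levels_ne ((Tiling.mem_levelTiles.1 ht).2.unique (Tiling.mem_levelTiles.1 h.right).2)
    have := h.exchangeMap_mem hn ht
    rw [exchangeMap, if_neg htA, if_neg htB] at this
    exact Finset.mem_filter.2 ⟨this, hlt⟩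
  · exact Finset.mem_filter.2 ⟨h.left', hl⟩
  · intro hmem
    have hA' := (Tiling.mem_levelTiles.1 (Finset.mem_filter.1 hmem).1).1
    by_cases e : A = A'
    · exact hnl (e ▸ hl)
    · exact hAA' (α.pairwiseDisjoint A (Tiling.mem_levelTiles.1 h.left).1 A' hA' e)

theorem edgeReversal_of_localMove (hn : 1 ≤ n) (hR : IsRegion R) (hsc : IsSimplyConnected R)
    {α β : Tiling n R} (h : LocalMove α β) :
    (tilingGraph α).EdgeReversal (tilingGraph β) := by
  obtain ⟨p, q, hp, hq, hpq, hpα, hqβ, hsd⟩ := h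
  obtain ⟨A, B, c, d, rfl, hAB, hcd, hA, hB⟩ := exists_pair_levels hn hp hpα
  obtain ⟨A', B', c', d', rfl, hAB', hcd', hA', hB'⟩ := exists_pair_levels hn hq hqβ
  have hAt := (Tiling.mem_levelTiles.1 hA).1
  have hBt := (Tiling.mem_levelTiles.1 hB).1
  have hA't := (Tiling.mem_levelTiles.1 hA').1
  have hB't := (Tiling.mem_levelTiles.1 hB').1
  have hun : A' ∪ B' = A ∪ B := Finset.ext fun s =>
    ⟨mem_union_of_sdiff_eq hA't hB't hsd.symm, mem_union_of_sdiff_eq hAt hBt hsd⟩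
  obtain ⟨rfl, rfl⟩ := levels_eq_of_union_eq hn (α.isStrand hn hA) (α.isStrand hn hB)
    (β.isStrand hn hA') (β.isStrand hn hB') hcd hcd' hun
  have hAs := α.isStrand hn hA
  have hBs := α.isStrand hn hB
  have hA's := β.isStrand hn hA'
  have hB's := β.isStrand hn hB'
  have hd := α.pairwiseDisjoint A hAt B hBt hAB
  have hd' := β.pairwiseDisjoint A' hA't B' hB't hAB'
  obtain ⟨hlt, hdc, hcross⟩ := crossing_of_union_eq hAs hBs hA's hB's hcd hd hd' hun hpq
  have hex := isExchange_of_sdiff_eq hA hB hA' hB' hlt.ne hun hsd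
  have hex' := isExchange_of_sdiff_eq hA' hB' hA hB hlt.ne hun.symm hsd.symm
  -- The squares of `A` and `B` on either side of the two staircases where `A'` and `B'` cross over.
  obtain ⟨a₁, ha₁, la₁⟩ := hAs.exists_mem (d' - 1) (by omega) (by omega)
  obtain ⟨b₁, hb₁, lb₁⟩ := hBs.exists_mem d' (by omega) (by omega)
  obtain ⟨a₂, ha₂, la₂⟩ := hAs.exists_mem (c' + n - 1) (by omega) (by omega)
  obtain ⟨b₂, hb₂, lb₂⟩ := hBs.exists_mem (c' + n) (by omega) (by omega)
  have ha₁' : a₁ ∈ A' :=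
    (Finset.mem_union.1 (hun.symm ▸ Finset.mem_union_left B ha₁)).resolve_right fun h => by
      have := hB's.bounds a₁ h; omega
  have hb₂' : b₂ ∈ B' :=
    (Finset.mem_union.1 (hun.symm ▸ Finset.mem_union_right A hb₂)).resolve_left fun h => by
      have := hA's.bounds b₂ h; omega
  have step1 := hA's.step a₁ ha₁' b₁ ((hcross b₁ (by omega) (by omega)).1 hb₁) (by omega)
  have step2 := hB's.step a₂ ((hcross a₂ (by omega) (by omega)).2 ha₂) b₂ hb₂' (by omega)
  have hAA' : ¬ Disjoint A A' := fun h => Finset.disjoint_left.1 h ha₁ ha₁'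
  have between : ∀ C ∈ α.family, C ≠ A → C ≠ B → ¬ (LeftOf A C ∧ LeftOf C B) ∧
      ¬ (LeftOf B C ∧ LeftOf C A) := by
    intro C hC hCA hCB
    have hF := α.isStrandFamily hn
    have hAf : A ∈ α.family := (Tiling.mem_family_iff hn).2 (.inl hAt)
    have hBf : B ∈ α.family := (Tiling.mem_family_iff hn).2 (.inl hBt)
    have dA := hF.disjoint A hAf C hC hCA.symm
    have dB := hF.disjoint B hBf C hC hCB.symm
    rw [← not_or]
    intro hbet
    obtain ⟨lo, hi, hlohi, hCs⟩ := hF.isStrand C hC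
    have hbd : c' ≤ hi + 1 ∧ lo ≤ c' + n ∧ d' ≤ hi + 1 ∧ lo ≤ d' + n := by
      rcases hbet with ⟨g1, g2⟩ | ⟨g1, g2⟩
      · have := g1.bounds hAs hCs; have := g2.bounds hCs hBs; omega
      · have := g1.bounds hBs hCs; have := g2.bounds hCs hAs; omega
    -- No square fits between adjacent squares of `A` and `B`.
    have squeeze : ∀ x ∈ A, ∀ y ∈ B, (pos y = pos x + 1 ∨ pos x = pos y + 1) → ∀ z ∈ C,
        Near x z → Near z y → False := by
      intro x hx y hy hxy z hz n1 n2
      rcases hbet with ⟨g1, g2⟩ | ⟨g1, g2⟩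
      · have := g1.pos_lt hAs hCs dA hx hz n1
        have := g2.pos_lt hCs hBs dB.symm hz hy n2
        omega
      · have := g1.pos_lt hBs hCs dB hy hz n2.symm
        have := g2.pos_lt hCs hAs dA.symm hz hx n1.symm
        omega
    have hlo : d' < lo := by
      by_contra hle
      obtain ⟨z, hz, lz⟩ := hCs.exists_mem (min hi d') (by omega) (by omega)
      exact squeeze a₁ ha₁ b₁ hb₁ step1 z hz (by unfold Near; omega) (by unfold Near; omega)
    have hhi : hi < c' + n - 1 := by
      by_contra hle
      obtain ⟨z, hz, lz⟩ := hCs.exists_mem (max lo (c' + n - 1)) (by omega) (by omega)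
      exact squeeze a₂ ha₂ b₂ hb₂ step2 z hz (by unfold Near; omega) (by unfold Near; omega)
    rcases (Tiling.mem_family_iff hn).1 hC with hCt | ⟨r, hr, rfl⟩
    · -- A tile is too long to fit strictly between the two staircases.
      obtain ⟨e, he⟩ := α.exists_levelTiles hn hCt
      have hes := α.isStrand hn he
      obtain ⟨x, hx, lx⟩ := hes.exists_mem e le_rfl (by omega)
      obtain ⟨y, hy, ly⟩ := hes.exists_mem (e + n - 1) (by omega) le_rfl
      have := hCs.bounds x hx
      have := hCs.bounds y hy
      omega
    · -- A boundary square would have `A` and `A'` on different sides.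
      have hlr := hCs.bounds r (Finset.mem_singleton_self r)
      obtain ⟨y, hy, ly⟩ := hBs.exists_mem (level r) (by omega) (by omega)
      have hy' := (hcross y (by omega) (by omega)).1 hy
      have hnear := near_of_level_eq ly
      have hmem := Finset.mem_singleton_self r
      have dA' : Disjoint A' {r} := by
        rw [Finset.disjoint_singleton_right]
        exact fun h => hr.1 (β.mem_region hA't h)
      rcases hbet with ⟨g1, g2⟩ | ⟨g1, g2⟩
      · have hl : LeftOf {r} A' :=
          leftOf_of_pos_lt hmem hy' hnear.symm (g2.pos_lt hCs hBs dB.symm hmem hy hnear.symm)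
        exact g1.asymm hAs hCs dA
          (hex.leftOf_square hn hR hsc hAA' hr.1 (by omega) (by omega) hl)
      · have hl : LeftOf A' {r} :=
          leftOf_of_pos_lt hy' hmem hnear (g1.pos_lt hBs hCs dB hy hmem hnear)
        exact hl.asymm hA's hCs dA' (hex'.leftOf_square hn hR hsc (fun h => hAA' h.symm) hr.1
          (by omega) (by omega) g2)
  obtain ⟨a, ha, la⟩ := hAs.exists_mem d' (by omega) (by omega)
  have haB' := (hcross a (by omega) (by omega)).2 ha
  have hbA' := (hcross b₁ (by omega) (by omega)).1 hb₁
  have hab : Near a b₁ := near_of_level_eq (la.trans lb₁.symm)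
  obtain ⟨i, hi⟩ := α.exists_represents hn hA
  obtain ⟨j, hj⟩ := α.exists_represents hn hB
  rcases leftOf_or hd ha hb₁ hab with hl | hl
  · have hc : α.Consecutive A B := ⟨hAt, hBt, hAB, hl, fun C hC h1 h2 => (between C hC h1 h2).1⟩
    obtain ⟨g1, g2, g3⟩ := hex.edgeReversal hn hR hsc hc
      (leftOf_of_pos_lt haB' hbA' hab (hl.pos_lt hAs hBs hd ha hb₁ hab)) hi hj
    exact ⟨_, _, g1, g2, tilingGraph_arc_asymm hn α g1, tilingGraph_arc_asymm hn β g2, g3⟩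
  · have hc : α.Consecutive B A :=
      ⟨hBt, hAt, hAB.symm, hl, fun C hC h1 h2 => (between C hC h2 h1).2⟩
    obtain ⟨g1, g2, g3⟩ := hex.symm.edgeReversal hn hR hsc hc
      (leftOf_of_pos_lt hbA' haB' hab.symm (hl.pos_lt hBs hAs hd.symm hb₁ ha hab.symm)) hj hi
    exact ⟨_, _, g1, g2, tilingGraph_arc_asymm hn α g1, tilingGraph_arc_asymm hn β g2, g3⟩

end

end Ribbon

theorem mainTheorem1 (n : ℕ) (hn : 1 ≤ n) (R : Finset Ribbon.Square)
    (hR : Ribbon.IsRegion R) (hsc : Ribbon.IsSimplyConnected R)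
    (hne : Nonempty (Ribbon.Tiling n R)) :
    Set.BijOn (fun α : Ribbon.Tiling n R => Ribbon.tilingGraph α) Set.univ
        (Ribbon.acyclicExtensions n R) ∧
      ∀ α β : Ribbon.Tiling n R,
        Ribbon.LocalMove α β ↔ (Ribbon.tilingGraph α).EdgeReversal (Ribbon.tilingGraph β) := by
  refine ⟨⟨fun α _ => Ribbon.tilingGraph_mem_acyclicExtensions hn hR hsc α,
    (Ribbon.tilingGraph_injective hn).injOn, fun O hO => ?_⟩, fun α β =>
    ⟨Ribbon.edgeReversal_of_localMove hn hR hsc, Ribbon.localMove_of_edgeReversal hn hR hsc⟩⟩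
  obtain ⟨β, hβ⟩ := Ribbon.exists_tilingGraph_eq hn hR hsc hO hne.some
  exact ⟨β, Set.mem_univ β, hβ⟩
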